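/- A *prop* is a strict symmetric monoidal category whose objects are the natural numbers, with tensor product of objects given by addition; a *morphism of props* is a strict symmetric monoidal functor that is the identity on objects. Let $\mathrm{PROP}$ be the category of props. Let $L$ be any set. An *$L$-circuit* from a finite set $X$ to a finite set $Y$ is a cospan of finite sets $X \xrightarrow{i} N \xleftarrow{o} Y$ together with a finite set $E$ and functions $s,t\colon E \to N$ and $\ell\colon E \to L$ (a finite directed $L$-labelled multigraph with node set $N$). Two $L$-circuits from $X$ to $Y$ are isomorphic if there are bijections of the node sets and of the edge sets compatible with $i,o,s,t,\ell$. Let $\mathrm{Circ}_L$ be the prop whose morphisms $m \to n$ are isomorphism classes of $L$-circuits from $\{0,\dots,m-1\}$ to $\{0,\dots,n-1\}$; cospans are composed by pushout over the common set $Y$, the composite graph having edge set $E+E'$ with sources and targets carried to $N+_Y N'$ and labels kept, and the tensor product is disjoint union. Let $\mathrm{FinCospan}$ be the prop whose morphisms $m\to n$ are isomorphism classes of cospans of finite sets from $\{0,\dots,m-1\}$ to $\{0,\dots,n-1\}$, composed by pushout and tensored by disjoint union. Let $F(L)$, the prop for $L$-actions, be the free prop generated by one morphism $\ell\colon 1\to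 1$ for each $\ell\in L$. Then $\mathrm{Circ}_L$ is the coproduct of $\mathrm{FinCospan}$ and $F(L)$ in $\mathrm{PROP}$, so $\mathrm{Circ}_L\cong \mathrm{FinCospan}+F(L)$. The coprojection $\mathrm{FinCospan}\to \mathrm{Circ}_L$ regards a cospan as an $L$-circuit with no edges, and the coprojection $F(L)\to\mathrm{Circ}_L$ sends the generator $\ell$ to the $L$-circuit with two nodes (one the input, the other the output) and a single edge, labelled $\ell$, from the input to the output. -/

import Mathlib

open CategoryTheory

universe u v w

/-! ## Props -/

/-- Transport of a morphism `m ⟶ n` along equalities of the objects `m` and `n`. -/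
def castHom {H : ℕ → ℕ → Type v} {m m' n n' : ℕ} (hm : m = m') (hn : n = n') (f : H m n) :
    H m' n' :=
  hn ▸ hm ▸ f

/-- A prop: a strict symmetric monoidal category whose objects are the natural numbers, the tensor
product of objects being addition.  Composition is written in diagrammatic order. -/
structure PropCat : Type (v + 1) where
  hom : ℕ → ℕ → Type v
  id : ∀ m, hom m m
  comp : ∀ {l m n}, hom l m → hom m n → hom l n
  tensor : ∀ {m n m' n'}, hom m n → hom m' n' → hom (m + m') (n + n')
  braid : ∀ m n, hom (m + n) (n + m)
  id_comp : ∀ {m n} (f : hom m n), comp (id m) f = f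
  comp_id : ∀ {m n} (f : hom m n), comp f (id n) = f
  assoc : ∀ {k l m n} (f : hom k l) (g : hom l m) (h : hom m n),
    comp (comp f g) h = comp f (comp g h)
  tensor_id : ∀ m n, tensor (id m) (id n) = id (m + n)
  tensor_comp : ∀ {l m n l' m' n'} (f : hom l m) (g : hom m n) (f' : hom l' m') (g' : hom m' n'),
    tensor (comp f g) (comp f' g') = comp (tensor f f') (tensor g g')
  tensor_assoc : ∀ {m n m' n' m'' n''} (f : hom m n) (g : hom m' n') (h : hom m'' n''),
    castHom (Nat.add_assoc _ _ _) (Nat.add_assoc _ _ _) (tensor (tensor f g) h) =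
      tensor f (tensor g h)
  id_zero_tensor : ∀ {m n} (f : hom m n),
    castHom (Nat.zero_add _) (Nat.zero_add _) (tensor (id 0) f) = f
  tensor_id_zero : ∀ {m n} (f : hom m n),
    castHom (Nat.add_zero _) (Nat.add_zero _) (tensor f (id 0)) = f
  braid_naturality : ∀ {m n m' n'} (f : hom m n) (g : hom m' n'),
    comp (tensor f g) (braid n n') = comp (braid m m') (tensor g f)
  braid_symm : ∀ m n, comp (braid m n) (braid n m) = id (m + n)
  braid_zero : ∀ n, castHom (Nat.zero_add _) (Nat.add_zero _) (braid 0 n) = id n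
  hexagon : ∀ l m n,
    castHom (Nat.add_assoc l m n) (Nat.add_assoc m n l).symm
      (comp (tensor (braid l m) (id n))
        (castHom (Nat.add_assoc m l n).symm rfl (tensor (id m) (braid l n)))) =
      braid l (m + n)

namespace PropCat

/-- A morphism of props: a strict symmetric monoidal functor that is the identity on objects. -/
@[ext]
structure Hom (P Q : PropCat.{v}) : Type v where
  map : ∀ {m n}, P.hom m n → Q.hom m n
  map_id : ∀ m, map (P.id m) = Q.id m
  map_comp : ∀ {l m n} (f : P.hom l m) (g : P.hom m n), map (P.comp f g) = Q.comp (map f) (map g)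
  map_tensor : ∀ {m n m' n'} (f : P.hom m n) (g : P.hom m' n'),
    map (P.tensor f g) = Q.tensor (map f) (map g)
  map_braid : ∀ m n, map (P.braid m n) = Q.braid m n

/-- The category of props. -/
instance : Category PropCat.{v} where
  Hom P Q := Hom P Q
  id P :=
    { map := fun f => f
      map_id := fun _ => rfl
      map_comp := fun _ _ => rfl
      map_tensor := fun _ _ => rfl
      map_braid := fun _ _ => rfl }
  comp F G :=
    { map := fun f => G.map (F.map f)
      map_id := fun m => by rw [F.map_id, G.map_id]
      map_comp := fun f g => by rw [F.map_comp, G.map_comp]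
      map_tensor := fun f g => by rw [F.map_tensor, G.map_tensor]
      map_braid := fun m n => by rw [F.map_braid, G.map_braid] }
  id_comp _ := rfl
  comp_id _ := rfl
  assoc _ _ _ := rfl

end PropCat

/-! ## Free props -/

namespace FreeProp

/-- Formal prop expressions in the operations of a signature `S`, where `S m n` is the set of
operations with `m` inputs and `n` outputs. -/
inductive Term (S : ℕ → ℕ → Type v) : ℕ → ℕ → Type v
  | gen {m n : ℕ} (x : S m n) : Term S m n
  | id (m : ℕ) : Term S m m
  | comp {l m n : ℕ} (f : Term S l m) (g : Term S m n) : Term S l n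
  | tensor {m n m' n' : ℕ} (f : Term S m n) (g : Term S m' n') : Term S (m + m') (n + n')
  | braid (m n : ℕ) : Term S (m + n) (n + m)

open Term in
/-- The congruence on expressions generated by the laws of a prop. -/
inductive Rel (S : ℕ → ℕ → Type v) : ∀ {m n : ℕ}, Term S m n → Term S m n → Prop
  | refl {m n : ℕ} (f : Term S m n) : Rel S f f
  | symm {m n : ℕ} {f g : Term S m n} : Rel S f g → Rel S g f
  | trans {m n : ℕ} {f g h : Term S m n} : Rel S f g → Rel S g h → Rel S f h
  | comp_congr {l m n : ℕ} {f f' : Term S l m} {g g' : Term S m n} :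
      Rel S f f' → Rel S g g' → Rel S (comp f g) (comp f' g')
  | tensor_congr {m n m' n' : ℕ} {f f' : Term S m n} {g g' : Term S m' n'} :
      Rel S f f' → Rel S g g' → Rel S (tensor f g) (tensor f' g')
  | id_comp {m n : ℕ} (f : Term S m n) : Rel S (comp (id m) f) f
  | comp_id {m n : ℕ} (f : Term S m n) : Rel S (comp f (id n)) f
  | assoc {k l m n : ℕ} (f : Term S k l) (g : Term S l m) (h : Term S m n) :
      Rel S (comp (comp f g) h) (comp f (comp g h))
  | tensor_id (m n : ℕ) : Rel S (tensor (id m) (id n)) (id (m + n))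
  | tensor_comp {l m n l' m' n' : ℕ} (f : Term S l m) (g : Term S m n) (f' : Term S l' m')
      (g' : Term S m' n') :
      Rel S (tensor (comp f g) (comp f' g')) (comp (tensor f f') (tensor g g'))
  | tensor_assoc {m n m' n' m'' n'' : ℕ} (f : Term S m n) (g : Term S m' n')
      (h : Term S m'' n'') :
      Rel S (castHom (Nat.add_assoc _ _ _) (Nat.add_assoc _ _ _) (tensor (tensor f g) h))
        (tensor f (tensor g h))
  | id_zero_tensor {m n : ℕ} (f : Term S m n) :
      Rel S (castHom (Nat.zero_add _) (Nat.zero_add _) (tensor (id 0) f)) f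
  | tensor_id_zero {m n : ℕ} (f : Term S m n) :
      Rel S (castHom (Nat.add_zero _) (Nat.add_zero _) (tensor f (id 0))) f
  | braid_naturality {m n m' n' : ℕ} (f : Term S m n) (g : Term S m' n') :
      Rel S (comp (tensor f g) (braid n n')) (comp (braid m m') (tensor g f))
  | braid_symm (m n : ℕ) : Rel S (comp (braid m n) (braid n m)) (id (m + n))
  | braid_zero (n : ℕ) :
      Rel S (castHom (Nat.zero_add _) (Nat.add_zero _) (braid 0 n)) (id n)
  | hexagon (l m n : ℕ) :
      Rel S (castHom (Nat.add_assoc l m n) (Nat.add_assoc m n l).symm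
        (comp (tensor (braid l m) (id n))
          (castHom (Nat.add_assoc m l n).symm rfl (tensor (id m) (braid l n)))))
        (braid l (m + n))

/-- The setoid of provable equality of expressions. -/
def termSetoid (S : ℕ → ℕ → Type v) (m n : ℕ) : Setoid (Term S m n) where
  r := Rel S
  iseqv := ⟨Rel.refl, Rel.symm, Rel.trans⟩

/-- Morphisms of the free prop: expressions modulo the laws of a prop. -/
def Mor (S : ℕ → ℕ → Type v) (m n : ℕ) : Type v := Quotient (termSetoid S m n)

/-- The class of an expression. -/
def mk {S : ℕ → ℕ → Type v} {m n : ℕ} (f : Term S m n) : Mor S m n :=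
  Quotient.mk (termSetoid S m n) f

theorem mk_eq {S : ℕ → ℕ → Type v} {m n : ℕ} {f g : Term S m n} (h : Rel S f g) : mk f = mk g :=
  Quotient.sound h

theorem mk_surj {S : ℕ → ℕ → Type v} {m n : ℕ} (f : Mor S m n) : ∃ t, mk t = f :=
  Quotient.exists_rep f

theorem castHom_mk {S : ℕ → ℕ → Type v} {m m' n n' : ℕ} (hm : m = m') (hn : n = n')
    (f : Term S m n) : castHom (H := Mor S) hm hn (mk f) = mk (castHom hm hn f) := by
  subst hm hn; rfl

/-- Composition of classes. -/
def Mor.comp {S : ℕ → ℕ → Type v} {l m n : ℕ} (f : Mor S l m) (g : Mor S m n) : Mor S l n :=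
  Quotient.map₂ Term.comp (fun _ _ h _ _ h' => Rel.comp_congr h h') f g

/-- Tensor product of classes. -/
def Mor.tensor {S : ℕ → ℕ → Type v} {m n m' n' : ℕ} (f : Mor S m n) (g : Mor S m' n') :
    Mor S (m + m') (n + n') :=
  Quotient.map₂ Term.tensor (fun _ _ h _ _ h' => Rel.tensor_congr h h') f g

theorem comp_mk {S : ℕ → ℕ → Type v} {l m n : ℕ} (f : Term S l m) (g : Term S m n) :
    (mk f).comp (mk g) = mk (f.comp g) := rfl

theorem tensor_mk {S : ℕ → ℕ → Type v} {m n m' n' : ℕ} (f : Term S m n) (g : Term S m' n') :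
    (mk f).tensor (mk g) = mk (f.tensor g) := rfl

end FreeProp

open FreeProp in
/-- The free prop on a signature. -/
def FreeProp (S : ℕ → ℕ → Type v) : PropCat.{v} where
  hom := Mor S
  id m := mk (.id m)
  comp := Mor.comp
  tensor := Mor.tensor
  braid m n := mk (.braid m n)
  id_comp f := by
    obtain ⟨f, rfl⟩ := mk_surj f
    exact mk_eq (.id_comp f)
  comp_id f := by
    obtain ⟨f, rfl⟩ := mk_surj f
    exact mk_eq (.comp_id f)
  assoc f g h := by
    obtain ⟨f, rfl⟩ := mk_surj f
    obtain ⟨g, rfl⟩ := mk_surj g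
    obtain ⟨h, rfl⟩ := mk_surj h
    exact mk_eq (.assoc f g h)
  tensor_id m n := mk_eq (.tensor_id m n)
  tensor_comp f g f' g' := by
    obtain ⟨f, rfl⟩ := mk_surj f
    obtain ⟨g, rfl⟩ := mk_surj g
    obtain ⟨f', rfl⟩ := mk_surj f'
    obtain ⟨g', rfl⟩ := mk_surj g'
    exact mk_eq (.tensor_comp f g f' g')
  tensor_assoc f g h := by
    obtain ⟨f, rfl⟩ := mk_surj f
    obtain ⟨g, rfl⟩ := mk_surj g
    obtain ⟨h, rfl⟩ := mk_surj h
    simp only [tensor_mk, castHom_mk]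
    exact mk_eq (.tensor_assoc f g h)
  id_zero_tensor f := by
    obtain ⟨f, rfl⟩ := mk_surj f
    simp only [tensor_mk, castHom_mk]
    exact mk_eq (.id_zero_tensor f)
  tensor_id_zero f := by
    obtain ⟨f, rfl⟩ := mk_surj f
    simp only [tensor_mk, castHom_mk]
    exact mk_eq (.tensor_id_zero f)
  braid_naturality f g := by
    obtain ⟨f, rfl⟩ := mk_surj f
    obtain ⟨g, rfl⟩ := mk_surj g
    exact mk_eq (.braid_naturality f g)
  braid_symm m n := mk_eq (.braid_symm m n)
  braid_zero n := by
    simp only [castHom_mk]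
    exact mk_eq (.braid_zero n)
  hexagon l m n := by
    simp only [tensor_mk, castHom_mk, comp_mk]
    exact mk_eq (.hexagon l m n)

namespace FreeProp

/-- Evaluation of expressions in a prop. -/
def eval {S : ℕ → ℕ → Type v} (P : PropCat.{w}) (φ : ∀ m n, S m n → P.hom m n) :
    ∀ {m n : ℕ}, Term S m n → P.hom m n
  | _, _, .gen x => φ _ _ x
  | _, _, .id m => P.id m
  | _, _, .comp f g => P.comp (eval P φ f) (eval P φ g)
  | _, _, .tensor f g => P.tensor (eval P φ f) (eval P φ g)
  | _, _, .braid m n => P.braid m n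

theorem eval_castHom {S : ℕ → ℕ → Type v} (P : PropCat.{w}) (φ : ∀ m n, S m n → P.hom m n)
    {m m' n n' : ℕ} (hm : m = m') (hn : n = n') (f : Term S m n) :
    eval P φ (castHom hm hn f) = castHom hm hn (eval P φ f) := by
  subst hm hn; rfl

theorem eval_rel {S : ℕ → ℕ → Type v} (P : PropCat.{w}) (φ : ∀ m n, S m n → P.hom m n)
    {m n : ℕ} {f g : Term S m n} (h : Rel S f g) : eval P φ f = eval P φ g := by
  induction h with
  | refl f => rfl
  | symm _ ih => exact ih.symm
  | trans _ _ ih ih' => exact ih.trans ih'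
  | comp_congr _ _ ih ih' => simp only [eval, ih, ih']
  | tensor_congr _ _ ih ih' => simp only [eval, ih, ih']
  | id_comp f => exact P.id_comp _
  | comp_id f => exact P.comp_id _
  | assoc f g h => exact P.assoc _ _ _
  | tensor_id m n => exact P.tensor_id m n
  | tensor_comp f g f' g' => exact P.tensor_comp _ _ _ _
  | tensor_assoc f g h => rw [eval_castHom]; exact P.tensor_assoc _ _ _
  | id_zero_tensor f => rw [eval_castHom]; exact P.id_zero_tensor _
  | tensor_id_zero f => rw [eval_castHom]; exact P.tensor_id_zero _
  | braid_naturality f g => exact P.braid_naturality _ _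
  | braid_symm m n => exact P.braid_symm m n
  | braid_zero n => rw [eval_castHom]; exact P.braid_zero n
  | hexagon l m n =>
    rw [eval_castHom]
    simp only [eval, eval_castHom]
    exact P.hexagon l m n

/-- The morphism out of a free prop determined by its values on the generators. -/
def lift {S : ℕ → ℕ → Type v} {P : PropCat.{v}} (φ : ∀ m n, S m n → P.hom m n) :
    FreeProp S ⟶ P :=
  show PropCat.Hom (FreeProp S) P from
  { map := fun f => Quotient.lift (eval P φ) (fun _ _ h => eval_rel P φ h) f
    map_id := fun _ => rfl
    map_comp := fun f g => by
      obtain ⟨f, rfl⟩ := mk_surj f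
      obtain ⟨g, rfl⟩ := mk_surj g
      rfl
    map_tensor := fun f g => by
      obtain ⟨f, rfl⟩ := mk_surj f
      obtain ⟨g, rfl⟩ := mk_surj g
      rfl
    map_braid := fun _ _ => rfl }

end FreeProp

/-- The signature with one operation `1 ⟶ 1` for each element of `L`, and no other operations. -/
inductive UnarySig (L : Type u) : ℕ → ℕ → Type (u + 1)
  | op (ℓ : L) : UnarySig L 1 1

/-- The prop for `L`-actions: the free prop with one morphism `1 ⟶ 1` for each label. -/
def ActionProp (L : Type u) : PropCat.{u + 1} := FreeProp (UnarySig L)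

/-! ## Pushouts of sets -/

/-- The pushout `N +_Y N'` of two functions `o : Y → N` and `i : Y → N'`. -/
def SetPushout {Y : Type w} {N N' : Type u} (o : Y → N) (i : Y → N') : Type u :=
  Quot (fun a b : N ⊕ N' => ∃ y, a = Sum.inl (o y) ∧ b = Sum.inr (i y))

namespace SetPushout

variable {Y : Type w} {N N' : Type u} {o : Y → N} {i : Y → N'}

instance [Finite N] [Finite N'] : Finite (SetPushout o i) := by
  unfold SetPushout; infer_instance

/-- The natural map `j : N + N' → N +_Y N'`. -/
def proj (o : Y → N) (i : Y → N') (a : N ⊕ N') : SetPushout o i := Quot.mk _ a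

theorem glue (y : Y) : proj o i (Sum.inl (o y)) = proj o i (Sum.inr (i y)) :=
  Quot.sound ⟨y, rfl, rfl⟩

/-- The universal property of the pushout. -/
def desc {Z : Type v} (f : N → Z) (g : N' → Z) (h : ∀ y, f (o y) = g (i y)) :
    SetPushout o i → Z :=
  Quot.lift (Sum.elim f g) (by rintro _ _ ⟨y, rfl, rfl⟩; exact h y)

@[simp] theorem desc_inl {Z : Type v} (f : N → Z) (g : N' → Z) (h : ∀ y, f (o y) = g (i y))
    (a : N) : desc f g h (proj o i (Sum.inl a)) = f a := rfl

@[simp] theorem desc_inr {Z : Type v} (f : N → Z) (g : N' → Z) (h : ∀ y, f (o y) = g (i y))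
    (a : N') : desc f g h (proj o i (Sum.inr a)) = g a := rfl

theorem ind {p : SetPushout o i → Prop} (hl : ∀ a, p (proj o i (Sum.inl a)))
    (hr : ∀ a, p (proj o i (Sum.inr a))) (x : SetPushout o i) : p x := by
  rcases x with ⟨a | a⟩
  · exact hl a
  · exact hr a

end SetPushout

/-! ## Cospans of finite sets and circuits -/

/-- A cospan `X → N ← Y` with finite apex `N`. -/
structure Cospan (X Y : Type) : Type (u + 1) where
  nodes : Type u
  [finite_nodes : Finite nodes]
  i : X → nodes
  o : Y → nodes

/-- An `L`-circuit from `X` to `Y`: a cospan `X → N ← Y` together with a finite `L`-labelled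
directed multigraph `s, t : E → N`, `label : E → L` on its apex. -/
structure Circuit (L : Type u) (X Y : Type) : Type (u + 1) extends Cospan.{u} X Y where
  edges : Type u
  [finite_edges : Finite edges]
  s : edges → nodes
  t : edges → nodes
  label : edges → L

attribute [instance] Cospan.finite_nodes Circuit.finite_edges

/-- An isomorphism of cospans. -/
structure Cospan.Iso {X Y : Type} (c c' : Cospan.{u} X Y) where
  node : c.nodes ≃ c'.nodes
  i_eq : ∀ x, node (c.i x) = c'.i x
  o_eq : ∀ y, node (c.o y) = c'.o y

/-- An isomorphism of circuits. -/
structure Circuit.Iso {L : Type u} {X Y : Type} (c c' : Circuit L X Y) extends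
    Cospan.Iso c.toCospan c'.toCospan where
  edge : c.edges ≃ c'.edges
  s_eq : ∀ e, node (c.s e) = c'.s (edge e)
  t_eq : ∀ e, node (c.t e) = c'.t (edge e)
  label_eq : ∀ e, c'.label (edge e) = c.label e

/-- Cospans up to isomorphism. -/
def cospanSetoid (X Y : Type) : Setoid (Cospan.{u} X Y) where
  r c c' := Nonempty (c.Iso c')
  iseqv :=
    { refl := fun c => ⟨⟨Equiv.refl _, fun _ => rfl, fun _ => rfl⟩⟩
      symm := by
        rintro c c' ⟨f⟩
        exact ⟨⟨f.node.symm, fun x => by rw [← f.i_eq, Equiv.symm_apply_apply],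
          fun x => by rw [← f.o_eq, Equiv.symm_apply_apply]⟩⟩
      trans := by
        rintro c c' c'' ⟨f⟩ ⟨g⟩
        exact ⟨⟨f.node.trans g.node, fun x => by simp [f.i_eq, g.i_eq],
          fun x => by simp [f.o_eq, g.o_eq]⟩⟩ }

/-- Circuits up to isomorphism. -/
def circuitSetoid (L : Type u) (X Y : Type) : Setoid (Circuit L X Y) where
  r c c' := Nonempty (c.Iso c')
  iseqv :=
    { refl := fun c => ⟨⟨⟨Equiv.refl _, fun _ => rfl, fun _ => rfl⟩, Equiv.refl _,
        fun _ => rfl, fun _ => rfl, fun _ => rfl⟩⟩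
      symm := by
        rintro c c' ⟨f⟩
        refine ⟨⟨⟨f.node.symm, fun x => ?_, fun x => ?_⟩, f.edge.symm,
          fun e => ?_, fun e => ?_, fun e => ?_⟩⟩
        · rw [← f.i_eq, Equiv.symm_apply_apply]
        · rw [← f.o_eq, Equiv.symm_apply_apply]
        · rw [Equiv.symm_apply_eq, f.s_eq, Equiv.apply_symm_apply]
        · rw [Equiv.symm_apply_eq, f.t_eq, Equiv.apply_symm_apply]
        · rw [← f.label_eq, Equiv.apply_symm_apply]
      trans := by
        rintro c c' c'' ⟨f⟩ ⟨g⟩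
        exact ⟨⟨⟨f.node.trans g.node, fun x => by simp [f.i_eq, g.i_eq],
          fun x => by simp [f.o_eq, g.o_eq]⟩, f.edge.trans g.edge,
          fun e => by simp [f.s_eq, g.s_eq], fun e => by simp [f.t_eq, g.t_eq],
          fun e => by simp [f.label_eq, g.label_eq]⟩⟩ }

namespace Cospan

/-- Precomposition of the two legs with functions. -/
def reindex {X Y X' Y' : Type} (c : Cospan.{u} X Y) (f : X' → X) (g : Y' → Y) :
    Cospan.{u} X' Y' where
  nodes := c.nodes
  i x := c.i (f x)
  o y := c.o (g y)

/-- The identity cospan. -/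
def id (X : Type) [Finite X] : Cospan.{u} X X where
  nodes := ULift.{u} X
  i := ULift.up
  o := ULift.up

/-- Composition of cospans by pushout. -/
def comp {X Y Z : Type} (c : Cospan.{u} X Y) (d : Cospan.{u} Y Z) : Cospan.{u} X Z where
  nodes := SetPushout c.o d.i
  i x := SetPushout.proj _ _ (Sum.inl (c.i x))
  o z := SetPushout.proj _ _ (Sum.inr (d.o z))

/-- Tensor product of cospans by disjoint union. -/
def tensor {X Y X' Y' : Type} (c : Cospan.{u} X Y) (d : Cospan.{u} X' Y') :
    Cospan.{u} (X ⊕ X') (Y ⊕ Y') where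
  nodes := c.nodes ⊕ d.nodes
  i := Sum.map c.i d.i
  o := Sum.map c.o d.o

/-- The braiding `X + Y → X + Y ← Y + X`. -/
def braid (X Y : Type) [Finite X] [Finite Y] : Cospan.{u} (X ⊕ Y) (Y ⊕ X) where
  nodes := ULift.{u} (X ⊕ Y)
  i := ULift.up
  o z := ULift.up z.swap

/-- A cospan regarded as a circuit with no edges. -/
def toCircuit (L : Type u) {X Y : Type} (c : Cospan.{u} X Y) : Circuit L X Y where
  toCospan := c
  edges := PEmpty
  s := PEmpty.elim
  t := PEmpty.elim
  label := PEmpty.elim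

end Cospan

namespace Circuit

variable {L : Type u}

/-- Precomposition of the two legs with functions. -/
def reindex {X Y X' Y' : Type} (c : Circuit L X Y) (f : X' → X) (g : Y' → Y) :
    Circuit L X' Y' where
  toCospan := c.toCospan.reindex f g
  edges := c.edges
  s := c.s
  t := c.t
  label := c.label

/-- Composition of circuits: the underlying cospans are composed by pushout, and the edges of both
circuits are kept. -/
def comp {X Y Z : Type} (c : Circuit L X Y) (d : Circuit L Y Z) : Circuit L X Z where
  toCospan := c.toCospan.comp d.toCospan
  edges := c.edges ⊕ d.edges
  s e := SetPushout.proj c.o d.i (Sum.map c.s d.s e)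
  t e := SetPushout.proj c.o d.i (Sum.map c.t d.t e)
  label := Sum.elim c.label d.label

/-- Tensor product of circuits by disjoint union. -/
def tensor {X Y X' Y' : Type} (c : Circuit L X Y) (d : Circuit L X' Y') :
    Circuit L (X ⊕ X') (Y ⊕ Y') where
  toCospan := c.toCospan.tensor d.toCospan
  edges := c.edges ⊕ d.edges
  s := Sum.map c.s d.s
  t := Sum.map c.t d.t
  label := Sum.elim c.label d.label

/-- The circuit consisting of one edge labelled `ℓ` from the single input to the single output. -/
def edge (ℓ : L) : Circuit L (Fin 1) (Fin 1) where
  nodes := PUnit.{u + 1} ⊕ PUnit.{u + 1}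
  i _ := Sum.inl PUnit.unit
  o _ := Sum.inr PUnit.unit
  edges := PUnit
  s _ := Sum.inl PUnit.unit
  t _ := Sum.inr PUnit.unit
  label _ := ℓ

end Circuit

/-! ## Operations on isomorphism classes -/

namespace Circuit

variable {L : Type u}

theorem comp_congr {X Y Z : Type} {c c' : Circuit L X Y} {d d' : Circuit L Y Z}
    (h : Nonempty (c.Iso c')) (h' : Nonempty (d.Iso d')) :
    Nonempty ((c.comp d).Iso (c'.comp d')) := by
  obtain ⟨f⟩ := h
  obtain ⟨g⟩ := h'
  refine ⟨⟨⟨⟨SetPushout.desc (fun a => SetPushout.proj _ _ (Sum.inl (f.node a)))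
      (fun a => SetPushout.proj _ _ (Sum.inr (g.node a))) ?_,
    SetPushout.desc (fun a => SetPushout.proj _ _ (Sum.inl (f.node.symm a)))
      (fun a => SetPushout.proj _ _ (Sum.inr (g.node.symm a))) ?_, ?_, ?_⟩, ?_, ?_⟩,
    Equiv.sumCongr f.edge g.edge, ?_, ?_, ?_⟩⟩
  · intro y; rw [f.o_eq, g.i_eq]; exact SetPushout.glue y
  · intro y; rw [← f.o_eq, ← g.i_eq, Equiv.symm_apply_apply, Equiv.symm_apply_apply]
    exact SetPushout.glue y
  · refine SetPushout.ind (fun a => ?_) (fun a => ?_)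
    · exact congrArg (fun z => SetPushout.proj _ _ (Sum.inl z)) (f.node.symm_apply_apply a)
    · exact congrArg (fun z => SetPushout.proj _ _ (Sum.inr z)) (g.node.symm_apply_apply a)
  · refine SetPushout.ind (fun a => ?_) (fun a => ?_)
    · exact congrArg (fun z => SetPushout.proj _ _ (Sum.inl z)) (f.node.apply_symm_apply a)
    · exact congrArg (fun z => SetPushout.proj _ _ (Sum.inr z)) (g.node.apply_symm_apply a)
  · intro x
    change SetPushout.proj _ _ (Sum.inl (f.node (c.i x))) = _
    rw [f.i_eq]; rfl
  · intro x
    change SetPushout.proj _ _ (Sum.inr (g.node (d.o x))) = _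
    rw [g.o_eq]; rfl
  · rintro (e | e)
    · change SetPushout.proj _ _ (Sum.inl (f.node (c.s e))) = _
      rw [f.s_eq]; rfl
    · change SetPushout.proj _ _ (Sum.inr (g.node (d.s e))) = _
      rw [g.s_eq]; rfl
  · rintro (e | e)
    · change SetPushout.proj _ _ (Sum.inl (f.node (c.t e))) = _
      rw [f.t_eq]; rfl
    · change SetPushout.proj _ _ (Sum.inr (g.node (d.t e))) = _
      rw [g.t_eq]; rfl
  · rintro (e | e)
    · exact f.label_eq e
    · exact g.label_eq e

theorem tensor_congr {X Y X' Y' : Type} {c c' : Circuit L X Y} {d d' : Circuit L X' Y'}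
    (h : Nonempty (c.Iso c')) (h' : Nonempty (d.Iso d')) :
    Nonempty ((c.tensor d).Iso (c'.tensor d')) := by
  obtain ⟨f⟩ := h
  obtain ⟨g⟩ := h'
  refine ⟨⟨⟨Equiv.sumCongr f.node g.node, ?_, ?_⟩, Equiv.sumCongr f.edge g.edge, ?_, ?_, ?_⟩⟩
  · rintro (x | x)
    · exact congrArg Sum.inl (f.i_eq x)
    · exact congrArg Sum.inr (g.i_eq x)
  · rintro (x | x)
    · exact congrArg Sum.inl (f.o_eq x)
    · exact congrArg Sum.inr (g.o_eq x)
  · rintro (x | x)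
    · exact congrArg Sum.inl (f.s_eq x)
    · exact congrArg Sum.inr (g.s_eq x)
  · rintro (x | x)
    · exact congrArg Sum.inl (f.t_eq x)
    · exact congrArg Sum.inr (g.t_eq x)
  · rintro (x | x)
    · exact f.label_eq x
    · exact g.label_eq x

theorem reindex_congr {X Y X' Y' : Type} {c c' : Circuit L X Y} (f : X' → X) (g : Y' → Y)
    (h : Nonempty (c.Iso c')) : Nonempty ((c.reindex f g).Iso (c'.reindex f g)) := by
  obtain ⟨k⟩ := h
  exact ⟨⟨⟨k.node, fun x => k.i_eq _, fun y => k.o_eq _⟩, k.edge, k.s_eq, k.t_eq, k.label_eq⟩⟩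

end Circuit

namespace Cospan

theorem toCircuit_congr (L : Type u) {X Y : Type} {c c' : Cospan.{u} X Y}
    (h : Nonempty (c.Iso c')) : Nonempty ((c.toCircuit L).Iso (c'.toCircuit L)) := by
  obtain ⟨f⟩ := h
  exact ⟨⟨f, Equiv.refl _, fun e => e.elim, fun e => e.elim, fun e => e.elim⟩⟩

theorem toCircuit_comp (L : Type u) {X Y Z : Type} (c : Cospan.{u} X Y) (d : Cospan.{u} Y Z) :
    Nonempty (((c.comp d).toCircuit L).Iso ((c.toCircuit L).comp (d.toCircuit L))) :=
  ⟨⟨⟨Equiv.refl _, fun _ => rfl, fun _ => rfl⟩,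
    ⟨fun e => e.elim, fun e => e.elim (fun e => e) (fun e => e), fun e => e.elim, fun e => e.elim (fun e => e.elim)
      (fun e => e.elim)⟩, fun e => e.elim, fun e => e.elim, fun e => e.elim⟩⟩

theorem toCircuit_tensor (L : Type u) {X Y X' Y' : Type} (c : Cospan.{u} X Y)
    (d : Cospan.{u} X' Y') :
    Nonempty (((c.tensor d).toCircuit L).Iso ((c.toCircuit L).tensor (d.toCircuit L))) :=
  ⟨⟨⟨Equiv.refl _, fun _ => rfl, fun _ => rfl⟩,
    ⟨fun e => e.elim, fun e => e.elim (fun e => e) (fun e => e), fun e => e.elim, fun e => e.elim (fun e => e.elim)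
      (fun e => e.elim)⟩, fun e => e.elim, fun e => e.elim, fun e => e.elim⟩⟩

theorem comp_congr {X Y Z : Type} {c c' : Cospan.{u} X Y} {d d' : Cospan.{u} Y Z}
    (h : Nonempty (c.Iso c')) (h' : Nonempty (d.Iso d')) :
    Nonempty ((c.comp d).Iso (c'.comp d')) := by
  obtain ⟨f⟩ := Circuit.comp_congr (toCircuit_congr PEmpty h) (toCircuit_congr PEmpty h')
  exact ⟨f.toIso⟩

theorem tensor_congr {X Y X' Y' : Type} {c c' : Cospan.{u} X Y} {d d' : Cospan.{u} X' Y'}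
    (h : Nonempty (c.Iso c')) (h' : Nonempty (d.Iso d')) :
    Nonempty ((c.tensor d).Iso (c'.tensor d')) := by
  obtain ⟨f⟩ := Circuit.tensor_congr (toCircuit_congr PEmpty h) (toCircuit_congr PEmpty h')
  exact ⟨f.toIso⟩

theorem reindex_congr {X Y X' Y' : Type} {c c' : Cospan.{u} X Y} (f : X' → X) (g : Y' → Y)
    (h : Nonempty (c.Iso c')) : Nonempty ((c.reindex f g).Iso (c'.reindex f g)) := by
  obtain ⟨k⟩ := h
  exact ⟨⟨k.node, fun x => k.i_eq _, fun y => k.o_eq _⟩⟩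

end Cospan

/-- Isomorphism classes of `L`-circuits from an `m`-element set to an `n`-element set. -/
def CircuitClass (L : Type u) (m n : ℕ) : Type (u + 1) :=
  Quotient (circuitSetoid L (Fin m) (Fin n))

namespace CircuitClass

variable {L : Type u}

/-- The isomorphism class of a circuit. -/
def mk {m n : ℕ} (c : Circuit L (Fin m) (Fin n)) : CircuitClass L m n :=
  Quotient.mk (circuitSetoid L (Fin m) (Fin n)) c

theorem mk_eq {m n : ℕ} {c d : Circuit L (Fin m) (Fin n)} (h : Nonempty (c.Iso d)) :
    mk c = mk d :=
  Quotient.sound h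

theorem mk_exact {m n : ℕ} {c d : Circuit L (Fin m) (Fin n)} (h : mk c = mk d) :
    Nonempty (c.Iso d) :=
  Quotient.exact h

theorem mk_surj {m n : ℕ} (c : CircuitClass L m n) : ∃ d, mk d = c :=
  Quotient.exists_rep c

/-- The identity morphism. -/
def id (L : Type u) (m : ℕ) : CircuitClass L m m := mk ((Cospan.id (Fin m)).toCircuit L)

/-- Composition of classes. -/
def comp {l m n : ℕ} (f : CircuitClass L l m) (g : CircuitClass L m n) : CircuitClass L l n :=
  Quotient.map₂ Circuit.comp (fun _ _ h _ _ h' => Circuit.comp_congr h h') f g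

/-- Tensor product of classes, identifying the set `m + m'` with the disjoint union of `m` and
`m'`. -/
def tensor {m n m' n' : ℕ} (f : CircuitClass L m n) (g : CircuitClass L m' n') :
    CircuitClass L (m + m') (n + n') :=
  Quotient.map₂
    (fun c d => (Circuit.tensor c d).reindex finSumFinEquiv.symm finSumFinEquiv.symm)
    (fun _ _ h _ _ h' => Circuit.reindex_congr _ _ (Circuit.tensor_congr h h')) f g

/-- The braiding. -/
def braid (L : Type u) (m n : ℕ) : CircuitClass L (m + n) (n + m) :=
  mk (((Cospan.braid (Fin m) (Fin n)).reindex
    finSumFinEquiv.symm finSumFinEquiv.symm).toCircuit L)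

theorem comp_mk {l m n : ℕ} (c : Circuit L (Fin l) (Fin m)) (d : Circuit L (Fin m) (Fin n)) :
    (mk c).comp (mk d) = mk (c.comp d) := rfl

theorem tensor_mk {m n m' n' : ℕ} (c : Circuit L (Fin m) (Fin n))
    (d : Circuit L (Fin m') (Fin n')) :
    (mk c).tensor (mk d) =
      mk ((c.tensor d).reindex finSumFinEquiv.symm finSumFinEquiv.symm) := rfl

theorem castHom_mk {m m' n n' : ℕ} (hm : m = m') (hn : n = n') (c : Circuit L (Fin m) (Fin n)) :
    castHom (H := CircuitClass L) hm hn (mk c) =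
      mk (c.reindex (Fin.cast hm.symm) (Fin.cast hn.symm)) := by
  subst hm hn; rfl

/-- Precomposing with a bijection, regarded as a circuit without edges, reindexes the inputs. -/
theorem perm_comp {m n : ℕ} {X : Type} [Finite X] (a : Fin m ≃ X) (b : Fin n ≃ X) {k : ℕ}
    (c : Circuit L (Fin n) (Fin k)) :
    (mk (((Cospan.id X).reindex a b).toCircuit L)).comp (mk c) =
      mk (c.reindex (fun x => b.symm (a x)) (fun y => y)) := by
  refine mk_eq ⟨⟨⟨⟨SetPushout.desc (fun z => c.i (b.symm z.down)) (fun z => z) ?_,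
    fun z => SetPushout.proj _ _ (Sum.inr z), ?_, ?_⟩, ?_, ?_⟩,
    ⟨Sum.elim (fun e => e.elim) (fun e => e), Sum.inr, ?_, ?_⟩, ?_, ?_, ?_⟩⟩
  · intro y
    change c.i (b.symm (b y)) = c.i y
    rw [Equiv.symm_apply_apply]
  · refine SetPushout.ind (fun z => ?_) (fun z => rfl)
    have := SetPushout.glue (o := (((Cospan.id.{u} X).reindex a b).toCircuit L).o) (i := c.i)
      (b.symm z.down)
    refine Eq.trans this.symm ?_
    congr 2
    change ULift.up (b (b.symm z.down)) = z
    rw [Equiv.apply_symm_apply]; rfl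
  · intro z; rfl
  · intro x; rfl
  · intro x; rfl
  · rintro (e | e)
    · exact e.elim
    · rfl
  · intro e; rfl
  · rintro (e | e)
    · exact e.elim
    · rfl
  · rintro (e | e)
    · exact e.elim
    · rfl
  · rintro (e | e)
    · exact e.elim
    · rfl

/-- Postcomposing with a bijection, regarded as a circuit without edges, reindexes the outputs. -/
theorem comp_perm {m n : ℕ} {X : Type} [Finite X] (a : Fin m ≃ X) (b : Fin n ≃ X) {k : ℕ}
    (c : Circuit L (Fin k) (Fin m)) :
    (mk c).comp (mk (((Cospan.id X).reindex a b).toCircuit L)) =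
      mk (c.reindex (fun x => x) (fun y => a.symm (b y))) := by
  refine mk_eq ⟨⟨⟨⟨SetPushout.desc (fun z => z) (fun z => c.o (a.symm z.down)) ?_,
    fun z => SetPushout.proj _ _ (Sum.inl z), ?_, ?_⟩, ?_, ?_⟩,
    ⟨Sum.elim (fun e => e) (fun e => e.elim), Sum.inl, ?_, ?_⟩, ?_, ?_, ?_⟩⟩
  · intro y
    change c.o y = c.o (a.symm (a y))
    rw [Equiv.symm_apply_apply]
  · refine SetPushout.ind (fun z => rfl) (fun z => ?_)
    have := SetPushout.glue (i := (((Cospan.id.{u} X).reindex a b).toCircuit L).i) (o := c.o)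
      (a.symm z.down)
    refine Eq.trans this ?_
    congr 2
    change ULift.up (a (a.symm z.down)) = z
    rw [Equiv.apply_symm_apply]; rfl
  · intro z; rfl
  · intro x; rfl
  · intro x; rfl
  · rintro (e | e)
    · rfl
    · exact e.elim
  · intro e; rfl
  · rintro (e | e)
    · rfl
    · exact e.elim
  · rintro (e | e)
    · rfl
    · exact e.elim
  · rintro (e | e)
    · rfl
    · exact e.elim

theorem id_comp {m n : ℕ} (f : CircuitClass L m n) : (id L m).comp f = f := by
  obtain ⟨c, rfl⟩ := mk_surj f
  exact perm_comp (Equiv.refl _) (Equiv.refl _) c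

theorem comp_id {m n : ℕ} (f : CircuitClass L m n) : f.comp (id L n) = f := by
  obtain ⟨c, rfl⟩ := mk_surj f
  exact comp_perm (Equiv.refl _) (Equiv.refl _) c

theorem assoc {k l m n : ℕ} (f : CircuitClass L k l) (g : CircuitClass L l m)
    (h : CircuitClass L m n) : (f.comp g).comp h = f.comp (g.comp h) := by
  obtain ⟨f, rfl⟩ := mk_surj f
  obtain ⟨g, rfl⟩ := mk_surj g
  obtain ⟨h, rfl⟩ := mk_surj h
  refine mk_eq ⟨⟨⟨⟨SetPushout.desc (SetPushout.desc
        (fun a => SetPushout.proj _ _ (Sum.inl a))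
        (fun a => SetPushout.proj _ _ (Sum.inr (SetPushout.proj _ _ (Sum.inl a)))) ?_)
      (fun a => SetPushout.proj _ _ (Sum.inr (SetPushout.proj _ _ (Sum.inr a)))) ?_,
    SetPushout.desc (fun a => SetPushout.proj _ _ (Sum.inl (SetPushout.proj _ _ (Sum.inl a))))
      (SetPushout.desc
        (fun a => SetPushout.proj _ _ (Sum.inl (SetPushout.proj _ _ (Sum.inr a))))
        (fun a => SetPushout.proj _ _ (Sum.inr a)) ?_) ?_, ?_, ?_⟩, ?_, ?_⟩,
    Equiv.sumAssoc _ _ _, ?_, ?_, ?_⟩⟩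
  · intro y
    exact SetPushout.glue (o := f.o) (i := (g.comp h).i) y
  · intro y
    exact congrArg (fun z => SetPushout.proj f.o (g.comp h).i (Sum.inr z))
      (SetPushout.glue (o := g.o) (i := h.i) y)
  · intro y
    exact SetPushout.glue (o := (f.comp g).o) (i := h.i) y
  · intro y
    exact congrArg (fun z => SetPushout.proj (f.comp g).o h.i (Sum.inl z))
      (SetPushout.glue (o := f.o) (i := g.i) y)
  · exact SetPushout.ind (SetPushout.ind (fun _ => rfl) (fun _ => rfl)) (fun _ => rfl)
  · exact SetPushout.ind (fun _ => rfl) (SetPushout.ind (fun _ => rfl) (fun _ => rfl))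
  · intro x; rfl
  · intro x; rfl
  · rintro ((e | e) | e) <;> rfl
  · rintro ((e | e) | e) <;> rfl
  · rintro ((e | e) | e) <;> rfl

theorem tensor_id (m n : ℕ) : (id L m).tensor (id L n) = id L (m + n) := by
  refine mk_eq ⟨⟨⟨⟨fun z => ULift.up (finSumFinEquiv (Sum.map ULift.down ULift.down z)),
    fun z => Sum.map ULift.up ULift.up (finSumFinEquiv.symm z.down), ?_, ?_⟩, ?_, ?_⟩,
    ⟨Sum.elim (fun e => e.elim) (fun e => e.elim), fun e => e.elim, ?_, ?_⟩, ?_, ?_, ?_⟩⟩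
  · intro z
    change Sum.map _ _ (finSumFinEquiv.symm (finSumFinEquiv _)) = z
    rw [Equiv.symm_apply_apply]
    rcases z with z | z <;> rfl
  · rintro ⟨z⟩
    obtain ⟨z, rfl⟩ := finSumFinEquiv.surjective z
    change ULift.up (finSumFinEquiv (Sum.map _ _ (Sum.map _ _
      (finSumFinEquiv.symm (finSumFinEquiv z))))) = _
    rw [Equiv.symm_apply_apply]
    rcases z with z | z <;> rfl
  · intro x
    obtain ⟨x, rfl⟩ := finSumFinEquiv.surjective x
    change ULift.up (finSumFinEquiv (Sum.map _ _ (Sum.map _ _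
      (finSumFinEquiv.symm (finSumFinEquiv x))))) = ULift.up _
    rw [Equiv.symm_apply_apply]
    rcases x with x | x <;> rfl
  · intro x
    obtain ⟨x, rfl⟩ := finSumFinEquiv.surjective x
    change ULift.up (finSumFinEquiv (Sum.map _ _ (Sum.map _ _
      (finSumFinEquiv.symm (finSumFinEquiv x))))) = ULift.up _
    rw [Equiv.symm_apply_apply]
    rcases x with x | x <;> rfl
  · rintro (e | e) <;> exact e.elim
  · rintro e; exact e.elim
  · rintro (e | e) <;> exact e.elim
  · rintro (e | e) <;> exact e.elim
  · rintro (e | e) <;> exact e.elim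

theorem tensor_comp {l m n l' m' n' : ℕ} (f : CircuitClass L l m) (g : CircuitClass L m n)
    (f' : CircuitClass L l' m') (g' : CircuitClass L m' n') :
    (f.comp g).tensor (f'.comp g') = (f.tensor f').comp (g.tensor g') := by
  obtain ⟨f, rfl⟩ := mk_surj f
  obtain ⟨g, rfl⟩ := mk_surj g
  obtain ⟨f', rfl⟩ := mk_surj f'
  obtain ⟨g', rfl⟩ := mk_surj g'
  refine mk_eq ⟨⟨⟨⟨Sum.elim
      (SetPushout.desc (fun a => SetPushout.proj _ _ (Sum.inl (Sum.inl a)))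
        (fun a => SetPushout.proj _ _ (Sum.inr (Sum.inl a))) ?_)
      (SetPushout.desc (fun a => SetPushout.proj _ _ (Sum.inl (Sum.inr a)))
        (fun a => SetPushout.proj _ _ (Sum.inr (Sum.inr a))) ?_),
    SetPushout.desc (Sum.map (fun a => SetPushout.proj _ _ (Sum.inl a))
        (fun a => SetPushout.proj _ _ (Sum.inl a)))
      (Sum.map (fun a => SetPushout.proj _ _ (Sum.inr a))
        (fun a => SetPushout.proj _ _ (Sum.inr a))) ?_, ?_, ?_⟩, ?_, ?_⟩,
    Equiv.sumSumSumComm _ _ _ _, ?_, ?_, ?_⟩⟩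
  · intro y
    have := SetPushout.glue
      (o := ((f.tensor f').reindex finSumFinEquiv.symm (finSumFinEquiv (m := m) (n := m')).symm).o)
      (i := ((g.tensor g').reindex finSumFinEquiv.symm finSumFinEquiv.symm).i)
      (finSumFinEquiv (Sum.inl y))
    change SetPushout.proj _ _ (Sum.inl (Sum.map _ _ (finSumFinEquiv.symm _))) =
      SetPushout.proj _ _ (Sum.inr (Sum.map _ _ (finSumFinEquiv.symm _))) at this
    rw [Equiv.symm_apply_apply] at this
    exact this
  · intro y
    have := SetPushout.glue
      (o := ((f.tensor f').reindex finSumFinEquiv.symm (finSumFinEquiv (m := m) (n := m')).symm).o)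
      (i := ((g.tensor g').reindex finSumFinEquiv.symm finSumFinEquiv.symm).i)
      (finSumFinEquiv (Sum.inr y))
    change SetPushout.proj _ _ (Sum.inl (Sum.map _ _ (finSumFinEquiv.symm _))) =
      SetPushout.proj _ _ (Sum.inr (Sum.map _ _ (finSumFinEquiv.symm _))) at this
    rw [Equiv.symm_apply_apply] at this
    exact this
  · intro y
    obtain ⟨y, rfl⟩ := finSumFinEquiv.surjective y
    change Sum.map _ _ (Sum.map f.o f'.o (finSumFinEquiv.symm (finSumFinEquiv y))) =
      Sum.map _ _ (Sum.map g.i g'.i (finSumFinEquiv.symm (finSumFinEquiv y)))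
    rw [Equiv.symm_apply_apply]
    rcases y with y | y
    · exact congrArg Sum.inl (SetPushout.glue (o := f.o) (i := g.i) y)
    · exact congrArg Sum.inr (SetPushout.glue (o := f'.o) (i := g'.i) y)
  · rintro (z | z)
    · revert z; exact SetPushout.ind (fun _ => rfl) (fun _ => rfl)
    · revert z; exact SetPushout.ind (fun _ => rfl) (fun _ => rfl)
  · exact SetPushout.ind (by rintro (z | z) <;> rfl) (by rintro (z | z) <;> rfl)
  · intro x
    change Sum.elim _ _ (Sum.map _ _ (finSumFinEquiv.symm x)) =
      SetPushout.proj _ _ (Sum.inl (Sum.map _ _ (finSumFinEquiv.symm x)))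
    rcases finSumFinEquiv.symm x with x | x <;> rfl
  · intro x
    change Sum.elim _ _ (Sum.map _ _ (finSumFinEquiv.symm x)) =
      SetPushout.proj _ _ (Sum.inr (Sum.map _ _ (finSumFinEquiv.symm x)))
    rcases finSumFinEquiv.symm x with x | x <;> rfl
  · rintro ((e | e) | (e | e)) <;> rfl
  · rintro ((e | e) | (e | e)) <;> rfl
  · rintro ((e | e) | (e | e)) <;> rfl

theorem symm_cast_assoc {a b c : ℕ} (h : a + (b + c) = a + b + c) (x : Fin (a + (b + c))) :
    Equiv.sumAssoc _ _ _ (Sum.map (finSumFinEquiv.symm : Fin (a + b) → _) (fun z : Fin c => z)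
      (finSumFinEquiv.symm (Fin.cast h x))) =
    Sum.map (fun z => z) (finSumFinEquiv.symm : Fin (b + c) → _) (finSumFinEquiv.symm x) := by
  obtain ⟨x, rfl⟩ := finSumFinEquiv.surjective x
  rcases x with x | x
  · have : Fin.cast h (finSumFinEquiv (Sum.inl x)) =
        finSumFinEquiv (Sum.inl (finSumFinEquiv (Sum.inl x))) := by
      ext; simp
    rw [this]; simp
  · obtain ⟨x, rfl⟩ := finSumFinEquiv.surjective x
    rcases x with x | x
    · have : Fin.cast h (finSumFinEquiv (Sum.inr (finSumFinEquiv (Sum.inl x)))) =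
          finSumFinEquiv (Sum.inl (finSumFinEquiv (Sum.inr x))) := by
        ext; simp
      rw [this]; simp
    · have : Fin.cast h (finSumFinEquiv (Sum.inr (finSumFinEquiv (Sum.inr x)))) =
          finSumFinEquiv (Sum.inr x) := by
        ext; simp [Nat.add_assoc]
      rw [this]; simp

theorem tensor_assoc {m n m' n' m'' n'' : ℕ} (f : CircuitClass L m n) (g : CircuitClass L m' n')
    (h : CircuitClass L m'' n'') :
    castHom (Nat.add_assoc _ _ _) (Nat.add_assoc _ _ _) ((f.tensor g).tensor h) =
      f.tensor (g.tensor h) := by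
  obtain ⟨f, rfl⟩ := mk_surj f
  obtain ⟨g, rfl⟩ := mk_surj g
  obtain ⟨h, rfl⟩ := mk_surj h
  simp only [tensor_mk, castHom_mk]
  refine mk_eq ⟨⟨⟨Equiv.sumAssoc _ _ _, ?_, ?_⟩, Equiv.sumAssoc _ _ _, ?_, ?_, ?_⟩⟩
  · intro x
    have key := symm_cast_assoc (Nat.add_assoc m m' m'').symm x
    change Equiv.sumAssoc _ _ _ (Sum.map (fun z => Sum.map f.i g.i (finSumFinEquiv.symm z)) h.i
      (finSumFinEquiv.symm (Fin.cast _ x))) =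
      Sum.map f.i (fun z => Sum.map g.i h.i (finSumFinEquiv.symm z)) (finSumFinEquiv.symm x)
    have e := congrArg (Sum.map f.i (Sum.map g.i h.i)) key
    rw [Sum.map_map] at e
    refine Eq.trans ?_ e
    rcases finSumFinEquiv.symm (Fin.cast (Nat.add_assoc m m' m'').symm x) with y | y
    · simp only [Sum.map_inl]
      rcases finSumFinEquiv.symm y with y | y <;> rfl
    · rfl
  · intro x
    have key := symm_cast_assoc (Nat.add_assoc n n' n'').symm x
    change Equiv.sumAssoc _ _ _ (Sum.map (fun z => Sum.map f.o g.o (finSumFinEquiv.symm z)) h.o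
      (finSumFinEquiv.symm (Fin.cast _ x))) =
      Sum.map f.o (fun z => Sum.map g.o h.o (finSumFinEquiv.symm z)) (finSumFinEquiv.symm x)
    have e := congrArg (Sum.map f.o (Sum.map g.o h.o)) key
    rw [Sum.map_map] at e
    refine Eq.trans ?_ e
    rcases finSumFinEquiv.symm (Fin.cast (Nat.add_assoc n n' n'').symm x) with y | y
    · simp only [Sum.map_inl]
      rcases finSumFinEquiv.symm y with y | y <;> rfl
    · rfl
  · rintro ((e | e) | e) <;> rfl
  · rintro ((e | e) | e) <;> rfl
  · rintro ((e | e) | e) <;> rfl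

theorem symm_cast_zero_add {m : ℕ} (h : m = 0 + m) (x : Fin m) :
    finSumFinEquiv.symm (Fin.cast h x) = Sum.inr x := by
  rw [Equiv.symm_apply_eq]; ext; simp

theorem symm_cast_add_zero {m : ℕ} (h : m = m + 0) (x : Fin m) :
    finSumFinEquiv.symm (Fin.cast h x) = Sum.inl x := by
  rw [Equiv.symm_apply_eq]; rfl

theorem id_zero_tensor {m n : ℕ} (f : CircuitClass L m n) :
    castHom (Nat.zero_add _) (Nat.zero_add _) ((id L 0).tensor f) = f := by
  obtain ⟨f, rfl⟩ := mk_surj f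
  unfold id
  simp only [tensor_mk, castHom_mk]
  refine mk_eq ⟨⟨⟨⟨Sum.elim (fun z => z.down.elim0) (fun z => z), Sum.inr, ?_, ?_⟩, ?_, ?_⟩,
    ⟨Sum.elim (fun e => e.elim) (fun e => e), Sum.inr, ?_, ?_⟩, ?_, ?_, ?_⟩⟩
  · rintro (z | z)
    · exact z.down.elim0
    · rfl
  · intro z; rfl
  · intro x
    change Sum.elim _ _ (Sum.map _ _ (finSumFinEquiv.symm (Fin.cast _ x))) = _
    rw [symm_cast_zero_add]; rfl
  · intro x
    change Sum.elim _ _ (Sum.map _ _ (finSumFinEquiv.symm (Fin.cast _ x))) = _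
    rw [symm_cast_zero_add]; rfl
  · rintro (e | e)
    · exact e.elim
    · rfl
  · intro e; rfl
  · rintro (e | e)
    · exact e.elim
    · rfl
  · rintro (e | e)
    · exact e.elim
    · rfl
  · rintro (e | e)
    · exact e.elim
    · rfl

theorem tensor_id_zero {m n : ℕ} (f : CircuitClass L m n) :
    castHom (Nat.add_zero _) (Nat.add_zero _) (f.tensor (id L 0)) = f := by
  obtain ⟨f, rfl⟩ := mk_surj f
  unfold id
  simp only [tensor_mk, castHom_mk]
  refine mk_eq ⟨⟨⟨⟨Sum.elim (fun z => z) (fun z => z.down.elim0), Sum.inl, ?_, ?_⟩, ?_, ?_⟩,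
    ⟨Sum.elim (fun e => e) (fun e => e.elim), Sum.inl, ?_, ?_⟩, ?_, ?_, ?_⟩⟩
  · rintro (z | z)
    · rfl
    · exact z.down.elim0
  · intro z; rfl
  · intro x
    change Sum.elim _ _ (Sum.map _ _ (finSumFinEquiv.symm (Fin.cast _ x))) = _
    rw [symm_cast_add_zero]; rfl
  · intro x
    change Sum.elim _ _ (Sum.map _ _ (finSumFinEquiv.symm (Fin.cast _ x))) = _
    rw [symm_cast_add_zero]; rfl
  · rintro (e | e)
    · rfl
    · exact e.elim
  · intro e; rfl
  · rintro (e | e)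
    · rfl
    · exact e.elim
  · rintro (e | e)
    · rfl
    · exact e.elim
  · rintro (e | e)
    · rfl
    · exact e.elim

/-- The braiding as the cospan of a bijection. -/
theorem braid_eq (m n : ℕ) :
    braid L m n = mk (((Cospan.id (Fin m ⊕ Fin n)).reindex finSumFinEquiv.symm
      (finSumFinEquiv.symm.trans (Equiv.sumComm (Fin n) (Fin m)))).toCircuit L) := rfl

theorem braid_naturality {m n m' n' : ℕ} (f : CircuitClass L m n) (g : CircuitClass L m' n') :
    (f.tensor g).comp (braid L n n') = (braid L m m').comp (g.tensor f) := by
  obtain ⟨f, rfl⟩ := mk_surj f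
  obtain ⟨g, rfl⟩ := mk_surj g
  rw [tensor_mk, tensor_mk, braid_eq, braid_eq, comp_perm, perm_comp]
  refine mk_eq ⟨⟨⟨Equiv.sumComm _ _, ?_, ?_⟩, Equiv.sumComm _ _, ?_, ?_, ?_⟩⟩
  · intro x
    obtain ⟨x, rfl⟩ := finSumFinEquiv.surjective x
    rcases x with x | x <;>
      simp [Circuit.reindex, Circuit.tensor, Cospan.reindex, Cospan.tensor] <;> rfl
  · intro x
    obtain ⟨x, rfl⟩ := finSumFinEquiv.surjective x
    rcases x with x | x <;>
      simp [Circuit.reindex, Circuit.tensor, Cospan.reindex, Cospan.tensor] <;> rfl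
  · rintro (e | e) <;> rfl
  · rintro (e | e) <;> rfl
  · rintro (e | e) <;> rfl

/-- Two bijections give the same circuit if they agree. -/
theorem perm_ext {m n : ℕ} {X Y : Type} [Finite X] [Finite Y] (a : Fin m ≃ X) (b : Fin n ≃ X)
    (a' : Fin m ≃ Y) (b' : Fin n ≃ Y) (h : ∀ y, a'.symm (b' y) = a.symm (b y)) :
    mk (((Cospan.id X).reindex a b).toCircuit L) =
      mk (((Cospan.id Y).reindex a' b').toCircuit L) := by
  refine mk_eq (Cospan.toCircuit_congr L ⟨⟨⟨fun z => ULift.up (a' (a.symm z.down)),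
    fun z => ULift.up (a (a'.symm z.down)), ?_, ?_⟩, ?_, ?_⟩⟩)
  · intro z; simp; rfl
  · intro z; simp; rfl
  · intro x
    change ULift.up (a' (a.symm (a x))) = ULift.up (a' x)
    rw [Equiv.symm_apply_apply]
  · intro y
    change ULift.up (a' (a.symm (b y))) = ULift.up (b' y)
    rw [← h, Equiv.apply_symm_apply]

theorem braid_symm (m n : ℕ) : (braid L m n).comp (braid L n m) = id L (m + n) := by
  rw [braid_eq m n, braid_eq n m, perm_comp]
  refine perm_ext (Equiv.trans _ (Equiv.trans (Equiv.symm _) finSumFinEquiv.symm)) _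
    (Equiv.refl _) (Equiv.refl _) ?_
  intro y
  simp

theorem braid_zero (n : ℕ) :
    castHom (Nat.zero_add _) (Nat.add_zero _) (braid L 0 n) = id L n := by
  rw [braid_eq, castHom_mk]
  refine perm_ext ((finCongr (Nat.zero_add n).symm).trans finSumFinEquiv.symm)
    ((finCongr (Nat.add_zero n).symm).trans (finSumFinEquiv.symm.trans (Equiv.sumComm _ _)))
    (Equiv.refl _) (Equiv.refl _) ?_
  intro y
  symm
  rw [Equiv.symm_apply_eq]
  change Equiv.sumComm _ _ (finSumFinEquiv.symm (Fin.cast (Nat.add_zero n).symm y)) =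
    finSumFinEquiv.symm (Fin.cast (Nat.zero_add n).symm y)
  rw [symm_cast_zero_add, symm_cast_add_zero]; rfl

/-- The tensor product of two bijections. -/
theorem perm_tensor {m n m' n' : ℕ} {X X' : Type} [Finite X] [Finite X'] (a : Fin m ≃ X)
    (b : Fin n ≃ X) (a' : Fin m' ≃ X') (b' : Fin n' ≃ X') :
    (mk (((Cospan.id X).reindex a b).toCircuit L)).tensor
        (mk (((Cospan.id X').reindex a' b').toCircuit L)) =
      mk (((Cospan.id (X ⊕ X')).reindex (finSumFinEquiv.symm.trans (Equiv.sumCongr a a'))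
        (finSumFinEquiv.symm.trans (Equiv.sumCongr b b'))).toCircuit L) := by
  refine mk_eq ⟨⟨⟨⟨Sum.elim (fun z => ULift.up (Sum.inl z.down)) (fun z => ULift.up (Sum.inr z.down)),
    fun z => Sum.map ULift.up ULift.up z.down, ?_, ?_⟩, ?_, ?_⟩,
    ⟨Sum.elim (fun e => e.elim) (fun e => e.elim), fun e => e.elim, ?_, ?_⟩, ?_, ?_, ?_⟩⟩
  · rintro (z | z) <;> rfl
  · rintro ⟨z | z⟩ <;> rfl
  · intro x
    change Sum.elim _ _ (Sum.map _ _ (finSumFinEquiv.symm x)) =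
      ULift.up (Equiv.sumCongr a a' (finSumFinEquiv.symm x))
    rcases finSumFinEquiv.symm x with x | x <;> rfl
  · intro x
    change Sum.elim _ _ (Sum.map _ _ (finSumFinEquiv.symm x)) =
      ULift.up (Equiv.sumCongr b b' (finSumFinEquiv.symm x))
    rcases finSumFinEquiv.symm x with x | x <;> rfl
  · rintro (e | e) <;> exact e.elim
  · rintro e; exact e.elim
  · rintro (e | e) <;> exact e.elim
  · rintro (e | e) <;> exact e.elim
  · rintro (e | e) <;> exact e.elim

theorem perm_cast {m n m' n' : ℕ} {X : Type} [Finite X] (a : Fin m ≃ X) (b : Fin n ≃ X)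
    (hm : m = m') (hn : n = n') :
    castHom (H := CircuitClass L) hm hn (mk (((Cospan.id X).reindex a b).toCircuit L)) =
      mk (((Cospan.id X).reindex ((finCongr hm.symm).trans a)
        ((finCongr hn.symm).trans b)).toCircuit L) := by
  subst hm hn; rfl

theorem perm_comp_perm {k m n : ℕ} {X Y : Type} [Finite X] [Finite Y] (a : Fin k ≃ X)
    (b : Fin m ≃ X) (a' : Fin m ≃ Y) (b' : Fin n ≃ Y) :
    (mk (((Cospan.id X).reindex a b).toCircuit L)).comp
        (mk (((Cospan.id Y).reindex a' b').toCircuit L)) =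
      mk (((Cospan.id Y).reindex ((a.trans b.symm).trans a') b').toCircuit L) :=
  perm_comp a b _

theorem id_eq (m : ℕ) : id L m =
    mk (((Cospan.id (Fin m)).reindex (Equiv.refl _) (Equiv.refl _)).toCircuit L) := rfl

theorem cast_assoc_inl {a b c : ℕ} (h : a + b + c = a + (b + c)) (x : Fin a) :
    Fin.cast h (finSumFinEquiv (Sum.inl (finSumFinEquiv (Sum.inl x)))) =
      finSumFinEquiv (Sum.inl x) := by
  ext; simp

theorem cast_assoc_mid {a b c : ℕ} (h : a + b + c = a + (b + c)) (x : Fin b) :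
    Fin.cast h (finSumFinEquiv (Sum.inl (finSumFinEquiv (Sum.inr x)))) =
      finSumFinEquiv (Sum.inr (finSumFinEquiv (Sum.inl x))) := by
  ext; simp

theorem cast_assoc_inr {a b c : ℕ} (h : a + b + c = a + (b + c)) (x : Fin c) :
    Fin.cast h (finSumFinEquiv (Sum.inr x)) =
      finSumFinEquiv (Sum.inr (finSumFinEquiv (Sum.inr x))) := by
  ext; simp [Nat.add_assoc]

theorem cast_assoc_inl' {a b c : ℕ} (h : a + (b + c) = a + b + c) (x : Fin a) :
    Fin.cast h (finSumFinEquiv (Sum.inl x)) =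
      finSumFinEquiv (Sum.inl (finSumFinEquiv (Sum.inl x))) := by
  ext; simp

theorem cast_assoc_mid' {a b c : ℕ} (h : a + (b + c) = a + b + c) (x : Fin b) :
    Fin.cast h (finSumFinEquiv (Sum.inr (finSumFinEquiv (Sum.inl x)))) =
      finSumFinEquiv (Sum.inl (finSumFinEquiv (Sum.inr x))) := by
  ext; simp

theorem cast_assoc_inr' {a b c : ℕ} (h : a + (b + c) = a + b + c) (x : Fin c) :
    Fin.cast h (finSumFinEquiv (Sum.inr (finSumFinEquiv (Sum.inr x)))) =
      finSumFinEquiv (Sum.inr x) := by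
  ext; simp [Nat.add_assoc]

theorem hexagon (l m n : ℕ) :
    castHom (Nat.add_assoc l m n) (Nat.add_assoc m n l).symm
      (((braid L l m).tensor (id L n)).comp
        (castHom (Nat.add_assoc m l n).symm rfl ((id L m).tensor (braid L l n)))) =
      braid L l (m + n) := by
  simp only [braid_eq, id_eq, perm_tensor, perm_cast, perm_comp_perm]
  apply perm_ext
  intro y
  symm
  rw [Equiv.symm_apply_eq]
  obtain ⟨y, rfl⟩ := finSumFinEquiv.surjective y
  rcases y with y | y
  on_goal 1 =>
    obtain ⟨y, rfl⟩ := finSumFinEquiv.surjective y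
    rcases y with y | y
  all_goals
    simp [-finSumFinEquiv_apply_left, -finSumFinEquiv_apply_right, cast_assoc_inl, cast_assoc_mid,
      cast_assoc_inr, cast_assoc_inl', cast_assoc_mid', cast_assoc_inr']

end CircuitClass

/-- The prop of `L`-circuits. -/
def Circ (L : Type u) : PropCat.{u + 1} where
  hom := CircuitClass L
  id := CircuitClass.id L
  comp := CircuitClass.comp
  tensor := CircuitClass.tensor
  braid := CircuitClass.braid L
  id_comp := CircuitClass.id_comp
  comp_id := CircuitClass.comp_id
  assoc := CircuitClass.assoc
  tensor_id := CircuitClass.tensor_id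
  tensor_comp := CircuitClass.tensor_comp
  tensor_assoc := CircuitClass.tensor_assoc
  id_zero_tensor := CircuitClass.id_zero_tensor
  tensor_id_zero := CircuitClass.tensor_id_zero
  braid_naturality := CircuitClass.braid_naturality
  braid_symm := CircuitClass.braid_symm
  braid_zero := CircuitClass.braid_zero
  hexagon := CircuitClass.hexagon

/-- Isomorphism classes of cospans of finite sets from an `m`-element set to an `n`-element
set. -/
def CospanClass (m n : ℕ) : Type (u + 1) := Quotient (cospanSetoid.{u} (Fin m) (Fin n))

namespace CospanClass

/-- The isomorphism class of a cospan. -/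
def mk {m n : ℕ} (c : Cospan.{u} (Fin m) (Fin n)) : CospanClass.{u} m n :=
  Quotient.mk (cospanSetoid (Fin m) (Fin n)) c

theorem mk_surj {m n : ℕ} (c : CospanClass.{u} m n) : ∃ d, mk d = c :=
  Quotient.exists_rep c

/-- The identity morphism. -/
def id (m : ℕ) : CospanClass.{u} m m := mk (Cospan.id (Fin m))

/-- Composition of classes. -/
def comp {l m n : ℕ} (f : CospanClass.{u} l m) (g : CospanClass.{u} m n) : CospanClass.{u} l n :=
  Quotient.map₂ Cospan.comp (fun _ _ h _ _ h' => Cospan.comp_congr h h') f g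

/-- Tensor product of classes, identifying the set `m + m'` with the disjoint union of `m` and
`m'`. -/
def tensor {m n m' n' : ℕ} (f : CospanClass.{u} m n) (g : CospanClass.{u} m' n') :
    CospanClass.{u} (m + m') (n + n') :=
  Quotient.map₂
    (fun c d => (Cospan.tensor c d).reindex finSumFinEquiv.symm finSumFinEquiv.symm)
    (fun _ _ h _ _ h' => Cospan.reindex_congr _ _ (Cospan.tensor_congr h h')) f g

/-- The braiding. -/
def braid (m n : ℕ) : CospanClass.{u} (m + n) (n + m) :=
  mk ((Cospan.braid (Fin m) (Fin n)).reindex finSumFinEquiv.symm finSumFinEquiv.symm)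

/-- The class of a cospan regarded as a circuit with no edges. -/
def toCircuit (L : Type u) {m n : ℕ} (f : CospanClass.{u} m n) : CircuitClass L m n :=
  Quotient.map (Cospan.toCircuit L) (fun _ _ h => Cospan.toCircuit_congr L h) f

theorem toCircuit_injective (L : Type u) {m n : ℕ} {f g : CospanClass.{u} m n}
    (h : f.toCircuit L = g.toCircuit L) : f = g := by
  obtain ⟨c, rfl⟩ := mk_surj f
  obtain ⟨d, rfl⟩ := mk_surj g
  obtain ⟨k⟩ := CircuitClass.mk_exact h
  exact Quotient.sound ⟨k.toIso⟩

theorem toCircuit_id (L : Type u) (m : ℕ) : (id m).toCircuit L = CircuitClass.id L m := rfl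

theorem toCircuit_braid (L : Type u) (m n : ℕ) :
    (braid m n).toCircuit L = CircuitClass.braid L m n := rfl

theorem toCircuit_comp (L : Type u) {l m n : ℕ} (f : CospanClass.{u} l m)
    (g : CospanClass.{u} m n) :
    (f.comp g).toCircuit L = (f.toCircuit L).comp (g.toCircuit L) := by
  obtain ⟨c, rfl⟩ := mk_surj f
  obtain ⟨d, rfl⟩ := mk_surj g
  exact CircuitClass.mk_eq (Cospan.toCircuit_comp L c d)

theorem toCircuit_tensor (L : Type u) {m n m' n' : ℕ} (f : CospanClass.{u} m n)
    (g : CospanClass.{u} m' n') :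
    (f.tensor g).toCircuit L = (f.toCircuit L).tensor (g.toCircuit L) := by
  obtain ⟨c, rfl⟩ := mk_surj f
  obtain ⟨d, rfl⟩ := mk_surj g
  exact CircuitClass.mk_eq (Circuit.reindex_congr _ _ (Cospan.toCircuit_tensor L c d))

theorem toCircuit_castHom (L : Type u) {m m' n n' : ℕ} (hm : m = m') (hn : n = n')
    (f : CospanClass.{u} m n) :
    toCircuit L (castHom (H := CospanClass.{u}) hm hn f) =
      castHom (H := CircuitClass L) hm hn (f.toCircuit L) := by
  subst hm hn; rfl

end CospanClass

open CospanClass in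
/-- The prop of cospans of finite sets. -/
def FinCospan : PropCat.{u + 1} where
  hom := CospanClass.{u}
  id := CospanClass.id
  comp := CospanClass.comp
  tensor := CospanClass.tensor
  braid := CospanClass.braid
  id_comp f := toCircuit_injective PEmpty <| by
    simp only [toCircuit_comp, toCircuit_id, CircuitClass.id_comp]
  comp_id f := toCircuit_injective PEmpty <| by
    simp only [toCircuit_comp, toCircuit_id, CircuitClass.comp_id]
  assoc f g h := toCircuit_injective PEmpty <| by
    simp only [toCircuit_comp, CircuitClass.assoc]
  tensor_id m n := toCircuit_injective PEmpty <| by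
    simp only [toCircuit_tensor, toCircuit_id, CircuitClass.tensor_id]
  tensor_comp f g f' g' := toCircuit_injective PEmpty <| by
    simp only [toCircuit_comp, toCircuit_tensor, CircuitClass.tensor_comp]
  tensor_assoc f g h := toCircuit_injective PEmpty <| by
    simp only [toCircuit_castHom, toCircuit_tensor, CircuitClass.tensor_assoc]
  id_zero_tensor f := toCircuit_injective PEmpty <| by
    simp only [toCircuit_castHom, toCircuit_tensor, toCircuit_id, CircuitClass.id_zero_tensor]
  tensor_id_zero f := toCircuit_injective PEmpty <| by
    simp only [toCircuit_castHom, toCircuit_tensor, toCircuit_id, CircuitClass.tensor_id_zero]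
  braid_naturality f g := toCircuit_injective PEmpty <| by
    simp only [toCircuit_comp, toCircuit_tensor, toCircuit_braid, CircuitClass.braid_naturality]
  braid_symm m n := toCircuit_injective PEmpty <| by
    simp only [toCircuit_comp, toCircuit_braid, toCircuit_id, CircuitClass.braid_symm]
  braid_zero n := toCircuit_injective PEmpty <| by
    simp only [toCircuit_castHom, toCircuit_braid, toCircuit_id, CircuitClass.braid_zero]
  hexagon l m n := toCircuit_injective PEmpty <| by
    simp only [toCircuit_castHom, toCircuit_comp, toCircuit_tensor, toCircuit_braid, toCircuit_id,
      CircuitClass.hexagon]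

/-! ## The two inclusions -/

/-- The morphism of props regarding a cospan as a circuit with no edges. -/
def cospanToCirc (L : Type u) : FinCospan.{u} ⟶ Circ L :=
  show PropCat.Hom FinCospan.{u} (Circ L) from
  { map := CospanClass.toCircuit L
    map_id := CospanClass.toCircuit_id L
    map_comp := CospanClass.toCircuit_comp L
    map_tensor := CospanClass.toCircuit_tensor L
    map_braid := CospanClass.toCircuit_braid L }

/-- The morphism of props sending the generator `ℓ` to the circuit with a single edge labelled
`ℓ`, from the input to the output. -/
def actionToCirc (L : Type u) : ActionProp L ⟶ Circ L :=
  FreeProp.lift (P := Circ L) (fun _ _ x =>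
    match x with
    | .op ℓ => CircuitClass.mk (Circuit.edge ℓ))

namespace PropCat

/-! ## Consequences of the laws of a prop -/

/-! In the prop of cospans the object 1 is self-dual: `cup` and `cap` satisfy the zigzag identity
`snake`. Let `G` be a morphism from `FinCospan` to a prop `P`, and let `a ℓ` be endomorphisms of 1
in `P`. Bending the input of `a ℓ` gives a state `edgeState` from 0 to 2. A circuit from m to n with
nodes N and edges e₁, …, eₖ then has a normal form: create the k states to the right of the m
inputs, and apply the image under `G` of the cospan from m + 2k to n with apex N whose left leg is i
followed by s(e₁), t(e₁), …, s(eₖ), t(eₖ). The expression `evalEdges` is this normal form in `P`.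

It depends only on the isomorphism class of the circuit. States have domain 0, so by naturality of
the braiding they can be permuted, and the cospan absorbs the permutation (`evalEdges_perm`);
renaming nodes does not change the class of the cospan (`evalEdges_equiv`). It respects composition,
because a cospan slides past states created after it and then composes with the next cospan by
pushout (`map_comp_evalEdges`, `evalEdges_comp`). For tensor products it suffices to treat
identities on the left (`whiskerLeft_evalEdges`), since the braiding supplies the rest
(`map_tensor_of_whiskerLeft`). This yields `evalHom`, which restricts to `G` on circuits without
edges and, by the zigzag identity, to `a` on single edges (`evalClass_edge`).

For uniqueness, the normal form computed in `Circ L` itself is the circuit it came from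
(`evalEdges_circ`). Every morphism of props preserves normal forms (`map_evalEdges`), so its values
on cospans and single edges determine it (`map_mk`). -/

theorem tensor_eq_whisker (P : PropCat.{v}) {m n m' n' : ℕ} (f : P.hom m n) (g : P.hom m' n') :
    P.tensor f g = P.comp (P.tensor f (P.id m')) (P.tensor (P.id n) g) := by
  rw [← P.tensor_comp, P.comp_id, P.id_comp]

theorem tensor_eq_whisker' (P : PropCat.{v}) {m n m' n' : ℕ} (f : P.hom m n) (g : P.hom m' n') :
    P.tensor f g = P.comp (P.tensor (P.id m) g) (P.tensor f (P.id n')) := by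
  rw [← P.tensor_comp, P.comp_id, P.id_comp]

/-- Conjugating by braidings trades right whiskering for left whiskering, so only the latter has to
be checked for a candidate morphism of props. -/
theorem whiskerRight_eq_braid (P : PropCat.{v}) {m n : ℕ} (f : P.hom m n) (r : ℕ) :
    P.tensor f (P.id r) =
      P.comp (P.braid m r) (P.comp (P.tensor (P.id r) f) (P.braid r n)) := by
  rw [P.braid_naturality, ← P.assoc, P.braid_symm, P.id_comp]

/-- Since m + 0 and n + 0 compute to m and n, the casts in the prop law are along reflexivity and
can be dropped. -/
theorem tensor_id_zero' (P : PropCat.{v}) {m n : ℕ} (f : P.hom m n) :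
    P.tensor f (P.id 0) = f :=
  P.tensor_id_zero f

theorem braid_zero_zero (P : PropCat.{v}) : P.braid 0 0 = P.id 0 :=
  P.braid_zero 0

/-- A functor on the underlying categories of two props which preserves the braiding and
tensoring with identities on the left preserves all tensor products. -/
theorem map_tensor_of_whiskerLeft {P Q : PropCat.{v}} (φ : ∀ {m n}, P.hom m n → Q.hom m n)
    (map_comp : ∀ {l m n} (f : P.hom l m) (g : P.hom m n), φ (P.comp f g) = Q.comp (φ f) (φ g))
    (map_braid : ∀ m n, φ (P.braid m n) = Q.braid m n)
    (map_whiskerLeft : ∀ (r : ℕ) {m n} (f : P.hom m n),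
      φ (P.tensor (P.id r) f) = Q.tensor (Q.id r) (φ f))
    {m n m' n' : ℕ} (f : P.hom m n) (g : P.hom m' n') :
    φ (P.tensor f g) = Q.tensor (φ f) (φ g) := by
  rw [P.tensor_eq_whisker, Q.tensor_eq_whisker, P.whiskerRight_eq_braid,
    Q.whiskerRight_eq_braid]
  simp only [map_comp, map_braid, map_whiskerLeft]

end PropCat

/-! ### Uniqueness of morphisms out of a free prop -/

namespace FreeProp

/-- Morphisms out of a free prop agree if they agree on the generators. -/
theorem hom_ext {S : ℕ → ℕ → Type v} {P : PropCat.{v}} {F F' : PropCat.Hom (FreeProp S) P}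
    (h : ∀ m n (x : S m n), F.map (mk (.gen x)) = F'.map (mk (.gen x))) : F = F' := by
  have key : ∀ {m n : ℕ} (t : Term S m n), F.map (mk t) = F'.map (mk t) := by
    intro m n t
    induction t with
    | gen x => exact h _ _ x
    | id m => exact (F.map_id m).trans (F'.map_id m).symm
    | comp f g ihf ihg =>
      exact (F.map_comp (mk f) (mk g)).trans
        ((congrArg₂ P.comp ihf ihg).trans (F'.map_comp (mk f) (mk g)).symm)
    | tensor f g ihf ihg =>
      exact (F.map_tensor (mk f) (mk g)).trans
        ((congrArg₂ P.tensor ihf ihg).trans (F'.map_tensor (mk f) (mk g)).symm)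
    | braid m n => exact (F.map_braid m n).trans (F'.map_braid m n).symm
  ext m n f
  obtain ⟨t, rfl⟩ := mk_surj f
  exact key t

end FreeProp

/-! ## Recognising pushouts of sets -/

/-- The commutative square with legs `j` and `j'` exhibits `Z` as the pushout of `o` and `i`. -/
structure IsSetPushout {Y : Type w} {N N' Z : Type u} (o : Y → N) (i : Y → N') (j : N → Z)
    (j' : N' → Z) : Prop where
  comm : ∀ y, j (o y) = j' (i y)
  surj : ∀ z, (∃ x, j x = z) ∨ (∃ x, j' x = z)
  retract : ∃ r : Z → SetPushout o i, (∀ x, r (j x) = SetPushout.proj o i (Sum.inl x)) ∧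
    ∀ x, r (j' x) = SetPushout.proj o i (Sum.inr x)

namespace IsSetPushout

theorem setPushout {Y : Type w} {N N' : Type u} (o : Y → N) (i : Y → N') :
    IsSetPushout o i (fun x => SetPushout.proj o i (Sum.inl x))
      (fun x => SetPushout.proj o i (Sum.inr x)) where
  comm := SetPushout.glue
  surj := SetPushout.ind (fun a => Or.inl ⟨a, rfl⟩) (fun a => Or.inr ⟨a, rfl⟩)
  retract := ⟨fun z => z, fun _ => rfl, fun _ => rfl⟩

/-- The hypotheses make `o` a bijection with inverse `b`, and pushing out along a bijection leaves
the other apex unchanged. This is how permutations and freshly created wires are absorbed. -/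
theorem of_leftInverse {Y : Type w} {N N' : Type u} {o : Y → N} {i : Y → N'} (b : N → Y)
    (hb : ∀ x, o (b x) = x) (hb' : ∀ y, b (o y) = y) :
    IsSetPushout o i (fun x => i (b x)) (fun x => x) where
  comm y := by rw [hb']
  surj z := Or.inr ⟨z, rfl⟩
  retract := ⟨fun z => SetPushout.proj o i (Sum.inr z),
    fun x => by beta_reduce; rw [← SetPushout.glue, hb], fun _ => rfl⟩

/-- Commutativity gives the comparison map to `Z`. The map `r` is a left inverse by its values on
the two legs, and a right inverse because the legs are jointly surjective. -/
theorem exists_equiv {Y : Type w} {N N' Z : Type u} {o : Y → N} {i : Y → N'} {j : N → Z}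
    {j' : N' → Z} (h : IsSetPushout o i j j') :
    ∃ e : SetPushout o i ≃ Z, (∀ x, e (SetPushout.proj o i (Sum.inl x)) = j x) ∧
      ∀ x, e (SetPushout.proj o i (Sum.inr x)) = j' x := by
  obtain ⟨r, hr, hr'⟩ := h.retract
  refine ⟨⟨SetPushout.desc j j' h.comm, r, SetPushout.ind hr hr', fun z => ?_⟩,
    fun _ => rfl, fun _ => rfl⟩
  rcases h.surj z with ⟨x, rfl⟩ | ⟨x, rfl⟩
  · rw [hr]; rfl
  · rw [hr']; rfl

end IsSetPushout

/-- Two cospans compose to the cospan on any pushout of their inner legs. -/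
theorem CospanClass.comp_mk_of_isSetPushout {l m n : ℕ} {N N' Z : Type u} [Finite N] [Finite N']
    [Finite Z] (i : Fin l → N) {o : Fin m → N} {i' : Fin m → N'} (o' : Fin n → N') {j : N → Z}
    {j' : N' → Z} (h : IsSetPushout o i' j j') :
    (CospanClass.mk ⟨N, i, o⟩).comp (CospanClass.mk ⟨N', i', o'⟩) =
      CospanClass.mk ⟨Z, fun x => j (i x), fun y => j' (o' y)⟩ := by
  obtain ⟨e, hl, hr⟩ := h.exists_equiv
  exact Quotient.sound ⟨⟨e, fun x => hl _, fun y => hr _⟩⟩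

/-! ### Adjoining the two ends of an edge to a leg -/

/-- Extend a function on `Fin m` by two values. -/
def extendPair {N : Type u} {m : ℕ} (i : Fin m → N) (s t : N) (x : Fin (m + 2)) : N :=
  Sum.elim i ![s, t] (finSumFinEquiv.symm x)

theorem comp_extendPair {N N' : Type u} {m : ℕ} (j : N → N') (i : Fin m → N) (s t : N) :
    (fun x => j (extendPair i s t x)) = extendPair (fun x => j (i x)) (j s) (j t) := by
  funext x
  unfold extendPair
  rcases finSumFinEquiv.symm x with y | y
  · rfl
  · fin_cases y <;> rfl

/-- A pushout is unchanged when the left foot is enlarged by two points glued to points of the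
right foot. -/
theorem IsSetPushout.extendPair {n : ℕ} {N N' Z : Type u} {o : Fin n → N} {i : Fin n → N'}
    {j : N → Z} {j' : N' → Z} (h : IsSetPushout o i j j') (s t : N') :
    IsSetPushout
      (fun x : Fin (n + 2) => Sum.map o (ULift.up.{u} (α := Fin 2)) (finSumFinEquiv.symm x))
      (extendPair i s t) (Sum.elim j (fun x => j' (![s, t] x.down))) j' where
  comm y := by
    unfold _root_.extendPair
    rcases finSumFinEquiv.symm y with y | y
    · exact h.comm y
    · rfl
  surj z := by
    rcases h.surj z with ⟨x, rfl⟩ | ⟨x, rfl⟩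
    · exact Or.inl ⟨Sum.inl x, rfl⟩
    · exact Or.inr ⟨x, rfl⟩
  retract := by
    obtain ⟨r, hr, hr'⟩ := h.retract
    have glue := SetPushout.glue
      (o := fun x : Fin (n + 2) => Sum.map o (ULift.up.{u} (α := Fin 2)) (finSumFinEquiv.symm x))
      (i := _root_.extendPair i s t)
    simp only [finSumFinEquiv.surjective.forall, _root_.extendPair,
      Equiv.symm_apply_apply] at glue
    -- The map back is the old one followed by the map from the old pushout to the enlarged one. A
    -- new point of the left apex needs no separate value, being glued to `s` or `t` on the right.
    refine ⟨fun z => SetPushout.desc (fun x => SetPushout.proj _ _ (Sum.inl (Sum.inl x)))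
      (fun x => SetPushout.proj _ _ (Sum.inr x)) (fun y => glue (Sum.inl y)) (r z), ?_, ?_⟩
    · rintro (x | x)
      · simp only [Sum.elim_inl, hr]; rfl
      · simp only [Sum.elim_inr, hr']; exact (glue (Sum.inr x.down)).symm
    · intro x
      simp only [hr']; rfl

theorem extendPair_inl {N : Type u} {m : ℕ} (i : Fin m → N) (s t : N) (x : Fin m) :
    extendPair i s t (finSumFinEquiv (Sum.inl x)) = i x := by
  rw [extendPair, Equiv.symm_apply_apply, Sum.elim_inl]

theorem extendPair_inr {N : Type u} {m : ℕ} (i : Fin m → N) (s t : N) (x : Fin 2) :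
    extendPair i s t (finSumFinEquiv (Sum.inr x)) = ![s, t] x := by
  rw [extendPair, Equiv.symm_apply_apply, Sum.elim_inr]

/-! ## Evaluation of circuits -/

namespace CircuitEval

/-- The cospan `0 → 1 ← 2`. -/
def cup : CospanClass.{u} 0 2 := CospanClass.mk ⟨PUnit, Fin.elim0, fun _ => PUnit.unit⟩

/-- The cospan `2 → 1 ← 0`. -/
def cap : CospanClass.{u} 2 0 := CospanClass.mk ⟨PUnit, fun _ => PUnit.unit, Fin.elim0⟩

variable {L : Type u} {P : PropCat.{u + 1}} (G : PropCat.Hom FinCospan.{u} P)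
  (a : L → P.hom 1 1)

/-- The morphism `0 ⟶ 2` naming the action of a label. -/
def edgeState (ℓ : L) : P.hom 0 2 := P.comp (G.map cup) (P.tensor (P.id 1) (a ℓ))

/-- Create the two ends of an edge labelled `ℓ` to the right of `m` wires. -/
def addEdge (m : ℕ) (ℓ : L) : P.hom m (m + 2) := P.tensor (P.id m) (edgeState G a ℓ)

/-- Evaluation of the circuit with node set `N`, given edges, inputs `i` and outputs `o`. -/
def evalEdges {n : ℕ} {N : Type u} [Finite N] (o : Fin n → N) :
    List (N × N × L) → ∀ m, (Fin m → N) → P.hom m n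
  | [], _, i => G.map (CospanClass.mk ⟨N, i, o⟩)
  | e :: es, m, i =>
    P.comp (addEdge G a m e.2.2) (evalEdges o es (m + 2) (extendPair i e.1 e.2.1))

/-! ### Interchange laws for creating edges -/

/-- Because the state starts at 0, both sides are the two ways of writing the tensor product of `f`
with it. -/
theorem comp_addEdge {m n : ℕ} (f : P.hom m n) (ℓ : L) :
    P.comp f (addEdge G a n ℓ) = P.comp (addEdge G a m ℓ) (P.tensor f (P.id 2)) := by
  refine Eq.trans ?_ (P.tensor_eq_whisker' f (edgeState G a ℓ))
  exact (congrArg (fun z => P.comp z (addEdge G a n ℓ)) (P.tensor_id_zero' f).symm).trans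
    (P.tensor_eq_whisker f (edgeState G a ℓ)).symm

/-- This is associativity of the tensor product. No cast appears because r + (m + 2) and r + m + 2
agree by computation. -/
theorem whiskerLeft_addEdge (r m : ℕ) (ℓ : L) :
    P.tensor (P.id r) (addEdge G a m ℓ) = addEdge G a (r + m) ℓ := by
  unfold addEdge
  rw [← P.tensor_id]
  exact (P.tensor_assoc (P.id r) (P.id m) (edgeState G a ℓ)).symm

theorem addEdge_addEdge (m : ℕ) (ℓ ℓ' : L) :
    P.comp (addEdge G a m ℓ) (addEdge G a (m + 2) ℓ') =
      P.tensor (P.id m) (P.tensor (edgeState G a ℓ) (edgeState G a ℓ')) := by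
  rw [← whiskerLeft_addEdge]
  refine (P.tensor_comp (P.id m) (P.id m) (edgeState G a ℓ) (addEdge G a 2 ℓ')).symm.trans ?_
  rw [P.id_comp]
  congr 1
  rw [P.tensor_eq_whisker (edgeState G a ℓ)]
  congr 1
  exact (P.tensor_id_zero' _).symm

/-- Naturality moves the braiding to the domains, where it is the trivial braiding of 0 with 0.
Hence states commute up to the braiding of their outputs. -/
theorem edgeState_tensor_comm (ℓ ℓ' : L) :
    P.comp (P.tensor (edgeState G a ℓ) (edgeState G a ℓ')) (P.braid 2 2) =
      P.tensor (edgeState G a ℓ') (edgeState G a ℓ) := by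
  rw [P.braid_naturality, P.braid_zero_zero]
  exact P.id_comp _

/-- The interchange of the last two pairs of wires. -/
def swapPairs (P : PropCat.{v}) (m : ℕ) : P.hom (m + 2 + 2) (m + 2 + 2) :=
  (P.tensor (P.id m) (P.braid 2 2) :)

theorem map_swapPairs (m : ℕ) : G.map (swapPairs FinCospan.{u} m) = swapPairs P m := by
  unfold swapPairs
  rw [← G.map_id, ← G.map_braid]
  exact G.map_tensor _ _

/-- Edges can be created in either order, up to the braiding. -/
theorem addEdge_comm (m : ℕ) (ℓ ℓ' : L) :
    P.comp (P.comp (addEdge G a m ℓ) (addEdge G a (m + 2) ℓ')) (swapPairs P m) =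
      P.comp (addEdge G a m ℓ') (addEdge G a (m + 2) ℓ) := by
  rw [addEdge_addEdge, addEdge_addEdge, ← edgeState_tensor_comm G a ℓ ℓ']
  refine (P.tensor_comp (P.id m) (P.id m) _ _).symm.trans ?_
  rw [P.id_comp]

/-! ### Algebra of evaluations of edge lists -/

/-- Precomposition of an evaluation with a cospan. -/
theorem map_comp_evalEdges {l n p : ℕ} {N N' Z : Type u} [Finite N] [Finite N'] [Finite Z]
    (i : Fin l → N) {o : Fin n → N} {i' : Fin n → N'} (o' : Fin p → N') {j : N → Z}
    {j' : N' → Z} (h : IsSetPushout o i' j j') (es : List (N' × N' × L)) :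
    P.comp (G.map (CospanClass.mk ⟨N, i, o⟩)) (evalEdges G a o' es n i') =
      evalEdges G a (fun y => j' (o' y)) (es.map fun e => (j' e.1, j' e.2.1, e.2.2)) l
        (fun x => j (i x)) := by
  induction es generalizing l n N with
  | nil =>
    exact (G.map_comp _ _).symm.trans
      (congrArg G.map (CospanClass.comp_mk_of_isSetPushout i o' h))
  | cons e es ih =>
    have key := ih (fun x : Fin (l + 2) =>
      Sum.map i (ULift.up.{u} (α := Fin 2)) (finSumFinEquiv.symm x)) (h.extendPair e.1 e.2.1)
    simp only [List.map_cons, evalEdges]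
    -- The new edge is created before the cospan instead of after it. The cospan is thereby tensored
    -- with the identity of 2, whose two points are glued to the ends of the edge, and `key` applies
    -- to this enlarged pushout.
    rw [← P.assoc, comp_addEdge, P.assoc]
    congr 1
    rw [← G.map_id]
    refine (congrArg (fun z => P.comp z _) (G.map_tensor _ _).symm).trans (key.trans ?_)
    congr 1
    funext x
    unfold extendPair
    rcases finSumFinEquiv.symm x with y | y
    · rfl
    · change j' (![e.1, e.2.1] y) = ![j' e.1, j' e.2.1] y
      fin_cases y <;> rfl

/-- Evaluations depend on the nodes only up to bijection. -/
theorem evalEdges_equiv {m n : ℕ} {N N' : Type u} [Finite N] [Finite N'] (f : N ≃ N')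
    (o : Fin n → N) (es : List (N × N × L)) (i : Fin m → N) :
    evalEdges G a (fun y => f (o y)) (es.map fun e => (f e.1, f e.2.1, e.2.2)) m
      (fun x => f (i x)) = evalEdges G a o es m i := by
  induction es generalizing m with
  | nil => exact congrArg G.map (Quotient.sound ⟨⟨f.symm, by simp, by simp⟩⟩)
  | cons e es ih =>
    simp only [List.map_cons, evalEdges]
    rw [← comp_extendPair f, ih]

/-- The interchange is the image of a cospan of bijections, so `map_comp_evalEdges` applies with a
pushout that adds no nodes and merely reindexes the input leg. -/
theorem swapPairs_evalEdges {m n : ℕ} {N : Type u} [Finite N] (o : Fin n → N)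
    (es : List (N × N × L)) (i : Fin m → N) (s t s' t' : N) :
    P.comp (swapPairs P m)
        (evalEdges G a o es (m + 2 + 2) (extendPair (extendPair i s t) s' t')) =
      evalEdges G a o es (m + 2 + 2) (extendPair (extendPair i s' t') s t) := by
  rw [← map_swapPairs G]
  have h := IsSetPushout.of_leftInverse
    (o := fun y : Fin (m + (2 + 2)) => Sum.map (ULift.up.{u} (α := Fin m))
      (fun z => ULift.up.{u} (finSumFinEquiv.symm z).swap) (finSumFinEquiv.symm y))
    (i := extendPair (extendPair i s t) s' t')
    -- The inverse of the output leg: it fixes the first `m` wires and exchanges the two pairs.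
    (Sum.elim (fun x => finSumFinEquiv (Sum.inl x.down))
      (fun z => finSumFinEquiv (Sum.inr (finSumFinEquiv z.down.swap))))
    (by rintro (x | ⟨x | x⟩) <;> simp)
    (by
      intro y
      obtain ⟨y, rfl⟩ := finSumFinEquiv.surjective y
      rcases y with y | y <;> simp)
  refine (map_comp_evalEdges G a (fun y : Fin (m + (2 + 2)) => Sum.map (ULift.up.{u} (α := Fin m))
      (fun z => ULift.up.{u} (finSumFinEquiv.symm z)) (finSumFinEquiv.symm y)) o h es).trans ?_
  simp only [List.map_id']
  congr 1
  funext x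
  -- The swap is read with the last four wires bracketed as 2 + 2, while `extendPair` adds them two
  -- at a time; the two readings agree by computation, and `key`, `key'` evaluate the leg in the
  -- first one.
  change Fin (m + (2 + 2)) at x
  obtain ⟨x, rfl⟩ := finSumFinEquiv.surjective x
  rcases x with x | x
  · simp only [Equiv.symm_apply_apply, Sum.map_inl, Sum.elim_inl]
    have key : ∀ s t s' t' : N, extendPair (extendPair i s t) s' t'
        (finSumFinEquiv (m := m) (n := 2 + 2) (Sum.inl x)) = i x := by
      intro s t s' t'
      change extendPair (extendPair i s t) s' t'
        (finSumFinEquiv (Sum.inl (finSumFinEquiv (Sum.inl x)))) = i x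
      rw [extendPair_inl, extendPair_inl]
    rw [key, key]
  · obtain ⟨x, rfl⟩ := finSumFinEquiv.surjective x
    have key : ∀ (s t s' t' : N) (y : Fin 2), extendPair (extendPair i s t) s' t'
        (finSumFinEquiv (m := m) (n := 2 + 2) (Sum.inr (finSumFinEquiv (Sum.inl y)))) =
          ![s, t] y := by
      intro s t s' t' y
      refine Eq.trans ?_ (extendPair_inr i s t y)
      refine Eq.trans ?_ (extendPair_inl (extendPair i s t) s' t' (finSumFinEquiv (Sum.inr y)))
      rfl
    have key' : ∀ (s t s' t' : N) (y : Fin 2), extendPair (extendPair i s t) s' t'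
        (finSumFinEquiv (m := m) (n := 2 + 2) (Sum.inr (finSumFinEquiv (Sum.inr y)))) =
          ![s', t'] y := by
      intro s t s' t' y
      refine Eq.trans ?_ (extendPair_inr (extendPair i s t) s' t' y)
      fin_cases y <;> rfl
    simp only [Equiv.symm_apply_apply, Sum.map_inr, Sum.elim_inr]
    rcases x with x | x
    · rw [key]; exact key' _ _ _ _ x
    · rw [key']; exact key _ _ _ _ x

/-- Evaluations do not depend on the order of the edges. -/
theorem evalEdges_perm {m n : ℕ} {N : Type u} [Finite N] (o : Fin n → N)
    {es es' : List (N × N × L)} (h : es.Perm es') (i : Fin m → N) :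
    evalEdges G a o es m i = evalEdges G a o es' m i := by
  induction h generalizing m with
  | nil => rfl
  | cons e _ ih => simp only [evalEdges, ih]
  | trans _ _ ih ih' => exact (ih i).trans (ih' i)
  | swap e e' es =>
    simp only [evalEdges]
    -- One order of creation is the other followed by `swapPairs`, and the remaining evaluation
    -- absorbs that interchange.
    rw [← P.assoc, ← P.assoc, ← addEdge_comm, P.assoc _ (swapPairs P m), swapPairs_evalEdges]

/-- Composition of evaluations. -/
theorem evalEdges_comp {l n p : ℕ} {N N' Z : Type u} [Finite N] [Finite N'] [Finite Z]
    (i : Fin l → N) {o : Fin n → N} {i' : Fin n → N'} (o' : Fin p → N') {j : N → Z}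
    {j' : N' → Z} (h : IsSetPushout o i' j j') (es : List (N × N × L))
    (es' : List (N' × N' × L)) :
    P.comp (evalEdges G a o es l i) (evalEdges G a o' es' n i') =
      evalEdges G a (fun y => j' (o' y))
        ((es.map fun e => (j e.1, j e.2.1, e.2.2)) ++
          es'.map fun e => (j' e.1, j' e.2.1, e.2.2)) l (fun x => j (i x)) := by
  induction es generalizing l with
  | nil => exact map_comp_evalEdges G a i o' h es'
  | cons e es ih =>
    simp only [List.map_cons, List.cons_append, evalEdges]
    rw [P.assoc, ih, comp_extendPair]

/-- Tensoring an evaluation with an identity on the left. -/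
theorem whiskerLeft_evalEdges (r : ℕ) {m n : ℕ} {N : Type u} [Finite N] (o : Fin n → N)
    (es : List (N × N × L)) (i : Fin m → N) :
    P.tensor (P.id r) (evalEdges G a o es m i) =
      evalEdges G a (N := ULift.{u} (Fin r) ⊕ N)
        (fun y => Sum.map ULift.up o (finSumFinEquiv.symm y))
        (es.map fun e => (Sum.inr e.1, Sum.inr e.2.1, e.2.2)) (r + m)
        (fun x => Sum.map ULift.up i (finSumFinEquiv.symm x)) := by
  induction es generalizing m with
  | nil =>
    rw [← G.map_id]
    exact (G.map_tensor _ _).symm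
  | cons e es ih =>
    simp only [List.map_cons, evalEdges]
    -- Splitting the identity on `r` in two lets interchange whisker the new edge and the remaining
    -- evaluation separately. What is left is an equality of input legs.
    rw [← P.id_comp (P.id r), P.tensor_comp, whiskerLeft_addEdge, ih]
    refine congrArg (P.comp _) (congrArg (evalEdges G a _ _ (r + m + 2)) ?_)
    funext x
    change Fin (r + (m + 2)) at x
    obtain ⟨x, rfl⟩ := finSumFinEquiv.surjective x
    rcases x with x | x
    · rw [Equiv.symm_apply_apply]
      refine Eq.trans ?_ (extendPair_inl _ _ _ (finSumFinEquiv (Sum.inl x))).symm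
      rw [Equiv.symm_apply_apply]
      rfl
    · rw [Equiv.symm_apply_apply, Sum.map_inr]
      obtain ⟨x, rfl⟩ := finSumFinEquiv.surjective x
      rcases x with x | x
      · rw [extendPair_inl]
        refine Eq.trans ?_ (extendPair_inl _ _ _ (finSumFinEquiv (Sum.inr x))).symm
        rw [Equiv.symm_apply_apply]
        rfl
      · rw [extendPair_inr]
        have hx : (finSumFinEquiv (Sum.inr (finSumFinEquiv (Sum.inr x))) : Fin (r + (m + 2))) =
            (finSumFinEquiv (Sum.inr x) : Fin (r + m + 2)) := by
          ext
          simp [Nat.add_assoc]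
        refine Eq.trans ?_ ((congrArg _ hx).trans (extendPair_inr _ _ _ x)).symm
        fin_cases x <;> rfl

/-! ### From edge lists to isomorphism classes of circuits -/

/-- The source, target and label of an edge. -/
def edgeData {X Y : Type} (c : Circuit L X Y) (e : c.edges) : c.nodes × c.nodes × L :=
  (c.s e, c.t e, c.label e)

/-- Some enumeration of the edges of a circuit. -/
noncomputable def edgeList {X Y : Type} (c : Circuit L X Y) : List c.edges :=
  (Set.finite_univ (α := c.edges)).toFinset.toList

theorem nodup_edgeList {X Y : Type} (c : Circuit L X Y) : (edgeList c).Nodup :=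
  Finset.nodup_toList _

theorem mem_edgeList {X Y : Type} (c : Circuit L X Y) (e : c.edges) : e ∈ edgeList c := by
  simp [edgeList]

theorem map_map_congr {α β γ δ : Type*} {f : α → β} {g : β → δ} {h : α → γ} {k : γ → δ}
    (l : List α) (H : ∀ x, g (f x) = k (h x)) : (l.map f).map g = (l.map h).map k := by
  rw [List.map_map, List.map_map]
  exact List.map_congr_left fun x _ => H x

/-- Evaluation of a circuit. -/
noncomputable def evalCircuit {m n : ℕ} (c : Circuit L (Fin m) (Fin n)) : P.hom m n :=
  evalEdges G a c.o ((edgeList c).map (edgeData c)) m c.i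

/-- A circuit can be evaluated using any enumeration of its edges. -/
theorem evalCircuit_eq {m n : ℕ} (c : Circuit L (Fin m) (Fin n)) (l : List c.edges)
    (hl : l.Nodup) (hl' : ∀ e, e ∈ l) :
    evalCircuit G a c = evalEdges G a c.o (l.map (edgeData c)) m c.i :=
  evalEdges_perm G a _ (((List.perm_ext_iff_of_nodup (nodup_edgeList c) hl).2
    fun e => ⟨fun _ => hl' e, fun _ => mem_edgeList c e⟩).map _) _

/-- The edge bijection carries the enumeration for `c` to an admissible one for `d`; the node
bijection then makes the two evaluations equal. -/
theorem evalCircuit_congr {m n : ℕ} {c d : Circuit L (Fin m) (Fin n)}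
    (h : Nonempty (c.Iso d)) : evalCircuit G a c = evalCircuit G a d := by
  obtain ⟨f⟩ := h
  rw [evalCircuit_eq G a d ((edgeList c).map f.edge)
    ((nodup_edgeList c).map f.edge.injective) (fun e => by
      obtain ⟨e, rfl⟩ := f.edge.surjective e
      exact List.mem_map_of_mem (mem_edgeList c e)), evalCircuit,
    ← evalEdges_equiv G a f.node, List.map_map, List.map_map]
  congr 1
  · exact funext f.o_eq
  · refine List.map_congr_left fun e _ => ?_
    simp only [edgeData, Function.comp_apply, f.s_eq, f.t_eq, f.label_eq]
  · exact funext f.i_eq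

/-- The edges of the composite may be enumerated by concatenation, which is the list produced by
`evalEdges_comp` for the standard pushout. -/
theorem evalCircuit_comp {l m n : ℕ} (c : Circuit L (Fin l) (Fin m))
    (d : Circuit L (Fin m) (Fin n)) :
    evalCircuit G a (c.comp d) = P.comp (evalCircuit G a c) (evalCircuit G a d) := by
  rw [evalCircuit_eq G a (c.comp d) ((edgeList c).map Sum.inl ++ (edgeList d).map Sum.inr)]
  · rw [evalCircuit, evalCircuit, evalEdges_comp G a _ _ (IsSetPushout.setPushout c.o d.i)]
    refine congrArg (fun es => evalEdges G a (c.comp d).o es l (c.comp d).i) ?_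
    exact List.map_append.trans (congrArg₂ (fun x y => x ++ y)
      (map_map_congr _ fun _ => rfl) (map_map_congr _ fun _ => rfl))
  · refine List.Nodup.append ((nodup_edgeList c).map Sum.inl_injective)
      ((nodup_edgeList d).map Sum.inr_injective) fun e he he' => ?_
    obtain ⟨x, -, rfl⟩ := List.mem_map.1 he
    obtain ⟨y, -, hy⟩ := List.mem_map.1 he'
    exact Sum.inr_ne_inl hy
  · rintro (e | e)
    · exact List.mem_append_left _ (List.mem_map_of_mem (mem_edgeList c e))
    · exact List.mem_append_right _ (List.mem_map_of_mem (mem_edgeList d e))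

theorem evalCircuit_whiskerLeft (r : ℕ) {m n : ℕ} (c : Circuit L (Fin m) (Fin n)) :
    evalCircuit G a ((((Cospan.id (Fin r)).toCircuit L).tensor c).reindex
      finSumFinEquiv.symm finSumFinEquiv.symm) = P.tensor (P.id r) (evalCircuit G a c) := by
  rw [evalCircuit_eq G a _ ((edgeList c).map Sum.inr)]
  · rw [evalCircuit, whiskerLeft_evalEdges]
    exact congrArg (fun es => evalEdges G a _ es _ _) (map_map_congr _ fun _ => rfl)
  · exact (nodup_edgeList c).map Sum.inr_injective
  · rintro (e | e)
    · exact e.elim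
    · exact List.mem_map_of_mem (mem_edgeList c e)

theorem evalCircuit_toCircuit {m n : ℕ} (c : Cospan.{u} (Fin m) (Fin n)) :
    evalCircuit G a (c.toCircuit L) = G.map (CospanClass.mk c) :=
  evalCircuit_eq G a (c.toCircuit L) [] List.nodup_nil (fun e => e.elim)

/-- Evaluation of classes of circuits. -/
noncomputable def evalClass {m n : ℕ} (f : CircuitClass L m n) : P.hom m n :=
  Quotient.lift (evalCircuit G a) (fun _ _ h => evalCircuit_congr G a h) f

theorem evalClass_toCircuit {m n : ℕ} (f : CospanClass.{u} m n) :
    evalClass G a (f.toCircuit L) = G.map f := by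
  obtain ⟨c, rfl⟩ := CospanClass.mk_surj f
  exact evalCircuit_toCircuit G a c

theorem evalClass_comp {l m n : ℕ} (f : CircuitClass L l m) (g : CircuitClass L m n) :
    evalClass G a (f.comp g) = P.comp (evalClass G a f) (evalClass G a g) := by
  obtain ⟨c, rfl⟩ := CircuitClass.mk_surj f
  obtain ⟨d, rfl⟩ := CircuitClass.mk_surj g
  exact evalCircuit_comp G a c d

theorem evalClass_braid (m n : ℕ) : evalClass G a (CircuitClass.braid L m n) = P.braid m n :=
  (evalClass_toCircuit G a (CospanClass.braid m n)).trans (G.map_braid m n)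

theorem evalClass_whiskerLeft (r : ℕ) {m n : ℕ} (f : CircuitClass L m n) :
    evalClass G a ((CircuitClass.id L r).tensor f) = P.tensor (P.id r) (evalClass G a f) := by
  obtain ⟨c, rfl⟩ := CircuitClass.mk_surj f
  exact evalCircuit_whiskerLeft G a r c

/-- The morphism of props evaluating circuits. -/
noncomputable def evalHom : PropCat.Hom (Circ L) P where
  map := evalClass G a
  map_id m := (evalClass_toCircuit G a (CospanClass.id m)).trans (G.map_id m)
  map_comp := evalClass_comp G a
  map_tensor := PropCat.map_tensor_of_whiskerLeft (P := Circ L) (evalClass G a)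
    (evalClass_comp G a) (evalClass_braid G a) (evalClass_whiskerLeft G a)
  map_braid := evalClass_braid G a

/-! ## Evaluation of a single edge -/

/-- The three middle points glue the four nodes along a path: identity wire to cap, cap to cup, cup
to the other identity wire. The pushout is therefore a single point. -/
theorem snake : CospanClass.comp ((CospanClass.id.{u} 1).tensor cup)
    (cap.tensor (CospanClass.id 1)) = CospanClass.id 1 := by
  refine (CospanClass.comp_mk_of_isSetPushout (m := 3) (Z := ULift.{u} (Fin 1)) _ _
    (j := fun _ => ULift.up 0) (j' := fun _ => ULift.up 0) ?_).trans ?_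
  · refine ⟨fun _ => rfl, fun z => Or.inl ⟨Sum.inr PUnit.unit, Subsingleton.elim _ _⟩,
      -- The representative chosen for the unique class is the node of the cap.
      fun _ => SetPushout.proj _ _ (Sum.inr (Sum.inl PUnit.unit)), ?_, ?_⟩
    · rintro (x | x)
      · obtain rfl : x = ULift.up 0 := Subsingleton.elim (α := ULift (Fin 1)) _ _
        exact (SetPushout.glue (0 : Fin 3)).symm
      · exact (SetPushout.glue (1 : Fin 3)).symm
    · rintro (x | x)
      · rfl
      · obtain rfl : x = ULift.up 0 := Subsingleton.elim (α := ULift (Fin 1)) _ _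
        exact (SetPushout.glue (1 : Fin 3)).symm.trans (SetPushout.glue (2 : Fin 3))
  · exact Quotient.sound ⟨⟨Equiv.refl _, fun _ => Subsingleton.elim (α := ULift (Fin 1)) _ _,
      fun _ => Subsingleton.elim (α := ULift (Fin 1)) _ _⟩⟩

/-- The right-hand side is the cospan in the normal form of a single edge: the input wire meets the
source end, and the target end goes on to the output. -/
theorem cap_tensor_id : cap.{u}.tensor (CospanClass.id 1) =
    CospanClass.mk ⟨PUnit.{u + 1} ⊕ PUnit.{u + 1},
      extendPair (fun _ : Fin 1 => Sum.inl PUnit.unit) (Sum.inl PUnit.unit) (Sum.inr PUnit.unit),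
      fun _ : Fin 1 => Sum.inr PUnit.unit⟩ := by
  refine Quotient.sound ⟨⟨⟨Sum.map (fun x => x) (fun _ => PUnit.unit),
    Sum.map (fun x => x) (fun _ => ULift.up 0), ?_, ?_⟩, ?_, ?_⟩⟩
  · rintro (x | x)
    · rfl
    · obtain rfl : x = ULift.up 0 := Subsingleton.elim (α := ULift (Fin 1)) _ _
      rfl
  · rintro (x | x) <;> rfl
  · intro x
    change Fin 3 at x
    fin_cases x <;> rfl
  · intro x
    change Fin 1 at x
    fin_cases x
    rfl

theorem addEdge_one (ℓ : L) : addEdge G a 1 ℓ =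
    P.comp (G.map ((CospanClass.id.{u} 1).tensor cup)) (P.tensor (P.id 2) (a ℓ) :) := by
  have h : P.tensor (P.id 2) (a ℓ) = P.tensor (P.id 1) (P.tensor (P.id 1) (a ℓ)) :=
    (congrArg (fun z => P.tensor z (a ℓ)) (P.tensor_id 1 1).symm).trans
      (P.tensor_assoc (P.id 1) (P.id 1) (a ℓ))
  have h' : G.map ((CospanClass.id.{u} 1).tensor cup) = P.tensor (P.id 1) (G.map cup) :=
    (G.map_tensor (m' := 0) (n' := 2) (CospanClass.id 1) cup).trans
      (congrArg (fun z => P.tensor z _) (G.map_id 1))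
  rw [h, h']
  refine Eq.trans ?_ (P.tensor_comp (P.id 1) (P.id 1) (G.map cup) (P.tensor (P.id 1) (a ℓ)))
  rw [P.id_comp]
  rfl

/-- The normal form is `a ℓ` on a wire bent by a cup and straightened by a cap. Sliding `a ℓ` past
the cap leaves the zigzag, which is the identity. -/
theorem evalClass_edge (ℓ : L) : evalClass G a (CircuitClass.mk (Circuit.edge ℓ)) = a ℓ := by
  refine (evalCircuit_eq G a (Circuit.edge ℓ) [PUnit.unit] (List.nodup_singleton _)
    (fun e => List.mem_singleton.2 rfl)).trans ?_
  change P.comp (addEdge G a 1 ℓ) (G.map (CospanClass.mk _)) = a ℓ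
  refine (congrArg (fun z => P.comp (addEdge G a 1 ℓ) (G.map z)) cap_tensor_id.symm).trans ?_
  rw [addEdge_one, P.assoc]
  have h : G.map (cap.{u}.tensor (CospanClass.id 1)) = P.tensor (G.map cap) (P.id 1) :=
    (G.map_tensor (m := 2) (n := 0) cap (CospanClass.id 1)).trans
      (congrArg (fun z => P.tensor _ z) (G.map_id 1))
  -- The cap and `a ℓ` act on disjoint wires, so they interchange; after the cap only 0 + 1 wires
  -- remain, and tensoring with the identity of 0 disappears.
  have h' : P.comp (P.tensor (P.id 2) (a ℓ)) (P.tensor (G.map cap) (P.id 1)) =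
      P.comp (G.map (cap.{u}.tensor (CospanClass.id 1))) (a ℓ) := by
    rw [← P.tensor_eq_whisker', h, P.tensor_eq_whisker]
    exact congrArg (P.comp _) (P.id_zero_tensor (a ℓ))
  refine (congrArg (P.comp _) ((congrArg (P.comp _) h).trans h')).trans ?_
  refine (P.assoc _ _ _).symm.trans ?_
  have h'' : P.comp (G.map ((CospanClass.id.{u} 1).tensor cup))
      (G.map (cap.tensor (CospanClass.id 1))) = P.id 1 :=
    (G.map_comp (l := 1) (m := 3) (n := 1) ((CospanClass.id.{u} 1).tensor cup)
      (cap.tensor (CospanClass.id 1))).symm.trans ((congrArg G.map snake).trans (G.map_id 1))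
  refine (congrArg (fun z => P.comp z (a ℓ)) h'').trans ?_
  exact P.id_comp _

/-! ## Circuits are generated by cospans and edges -/

/-- A normal form is built from prop operations, cospans and labels alone. For `P` equal to `Circ L`
this reduces uniqueness to the generators. -/
theorem map_evalEdges {Q : PropCat.{u + 1}} (F : PropCat.Hom P Q) (G' : PropCat.Hom FinCospan.{u} Q)
    (hG : ∀ {m n : ℕ} (f : CospanClass.{u} m n), F.map (G.map f) = G'.map f)
    {m n : ℕ} {N : Type u} [Finite N] (o : Fin n → N)
    (es : List (N × N × L)) (i : Fin m → N) :
    F.map (evalEdges G a o es m i) = evalEdges G' (fun ℓ => F.map (a ℓ)) o es m i := by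
  induction es generalizing m with
  | nil => exact hG _
  | cons e es ih =>
    simp only [evalEdges, F.map_comp, ih]
    congr 1
    refine (F.map_tensor (P.id m) (edgeState G a e.2.2)).trans ?_
    rw [F.map_id, edgeState, F.map_comp, hG]
    refine congrArg (fun z => Q.tensor (Q.id m) (Q.comp (G'.map cup) z)) ?_
    exact (F.map_tensor (P.id 1) (a e.2.2)).trans (by rw [F.map_id])

/-- The circuit with given nodes and list of edges. -/
def ofList {X Y : Type} {N : Type u} [Finite N] (i : X → N) (o : Y → N)
    (es : List (N × N × L)) : Circuit L X Y where
  nodes := N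
  i := i
  o := o
  edges := ULift.{u} (Fin es.length)
  s e := (es.get e.down).1
  t e := (es.get e.down).2.1
  label e := (es.get e.down).2.2

theorem mk_eq_ofList {m n : ℕ} (c : Circuit L (Fin m) (Fin n)) :
    CircuitClass.mk c =
      CircuitClass.mk (ofList c.i c.o ((edgeList c).map (edgeData c))) := by
  classical
  let f := (nodup_edgeList c).getEquivOfForallMemList _ (mem_edgeList c)
  have hf : ∀ e, (edgeList c).get (f.symm e) = e := fun e => f.apply_symm_apply e
  have key : ∀ e, ((edgeList c).map (edgeData c)).get
      (finCongr (List.length_map _).symm (f.symm e)) = edgeData c e := by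
    intro e
    simpa using congrArg (edgeData c) (hf e)
  refine CircuitClass.mk_eq ⟨⟨⟨Equiv.refl _, fun _ => rfl, fun _ => rfl⟩,
    (f.symm.trans (finCongr (List.length_map _).symm)).trans Equiv.ulift.symm, ?_, ?_, ?_⟩⟩
  · intro e
    exact (congrArg Prod.fst (key e)).symm
  · intro e
    exact (congrArg (fun x => x.2.1) (key e)).symm
  · intro e
    exact congrArg (fun x => x.2.2) (key e)

/-- Two circuits compose to the circuit on any pushout of their inner legs. -/
theorem comp_mk_of_isSetPushout {l m n : ℕ} (c : Circuit L (Fin l) (Fin m))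
    (d : Circuit L (Fin m) (Fin n)) {Z : Type u} [Finite Z] {j : c.nodes → Z} {j' : d.nodes → Z}
    (h : IsSetPushout c.o d.i j j') :
    (CircuitClass.mk c).comp (CircuitClass.mk d) = CircuitClass.mk
      { nodes := Z
        i := fun x => j (c.i x)
        o := fun y => j' (d.o y)
        edges := c.edges ⊕ d.edges
        s := Sum.elim (fun e => j (c.s e)) (fun e => j' (d.s e))
        t := Sum.elim (fun e => j (c.t e)) (fun e => j' (d.t e))
        label := Sum.elim c.label d.label } := by
  obtain ⟨f, hf, hf'⟩ := h.exists_equiv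
  refine CircuitClass.mk_eq ⟨⟨⟨f, fun x => hf _, fun y => hf' _⟩, Equiv.refl _, ?_, ?_, ?_⟩⟩
  · rintro (e | e)
    · exact hf _
    · exact hf' _
  · rintro (e | e)
    · exact hf _
    · exact hf' _
  · rintro (e | e) <;> rfl

/-- The circuit `0 ⟶ 2` with a single edge from the first output to the second. -/
def stateCircuit (ℓ : L) : Circuit L (Fin 0) (Fin 2) where
  nodes := PUnit.{u + 1} ⊕ PUnit.{u + 1}
  i := Fin.elim0
  o := ![Sum.inl PUnit.unit, Sum.inr PUnit.unit]
  edges := PUnit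
  s _ := Sum.inl PUnit.unit
  t _ := Sum.inr PUnit.unit
  label _ := ℓ

theorem edgeState_circ (ℓ : L) :
    edgeState (P := Circ L) (cospanToCirc L) (fun ℓ => CircuitClass.mk (Circuit.edge ℓ)) ℓ =
      CircuitClass.mk (stateCircuit ℓ) := by
  -- The node of the cup, the identity wire and the source of the edge are glued to the first node
  -- of the pushout; the target of the edge is the second.
  refine (comp_mk_of_isSetPushout (m := 2) (Z := PUnit.{u + 1} ⊕ PUnit.{u + 1}) _ _
    (j := fun _ => Sum.inl PUnit.unit) (j' := Sum.elim (fun _ => Sum.inl PUnit.unit) (fun x => x))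
    ⟨?_, ?_, Sum.elim (fun x => SetPushout.proj _ _ (Sum.inl x))
      (fun x => SetPushout.proj _ _ (Sum.inr (Sum.inr (Sum.inr x)))), ?_, ?_⟩).trans ?_
  · intro y
    fin_cases y <;> rfl
  · intro z
    exact Or.inr ⟨Sum.inr z, rfl⟩
  · intro x
    rfl
  · rintro (x | (x | x))
    · obtain rfl : x = ULift.up 0 := Subsingleton.elim (α := ULift (Fin 1)) _ _
      exact SetPushout.glue (0 : Fin 2)
    · exact SetPushout.glue (1 : Fin 2)
    · rfl
  · refine CircuitClass.mk_eq ⟨⟨⟨Equiv.refl _, fun x => x.elim0, fun x => ?_⟩,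
      ⟨fun _ => PUnit.unit, fun _ => Sum.inr (Sum.inr PUnit.unit), ?_, ?_⟩, ?_, ?_, ?_⟩⟩
    · fin_cases x <;> rfl
    · rintro (⟨⟨⟩⟩ | (⟨⟨⟩⟩ | e))
      rfl
    · intro e; rfl
    · rintro (⟨⟨⟩⟩ | (⟨⟨⟩⟩ | e))
      rfl
    · rintro (⟨⟨⟩⟩ | (⟨⟨⟩⟩ | e))
      rfl
    · rintro (⟨⟨⟩⟩ | (⟨⟨⟩⟩ | e))
      rfl

/-- Every list of edges evaluates in the prop of circuits to the circuit it describes. -/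
theorem evalEdges_circ {m n : ℕ} {N : Type u} [Finite N] (o : Fin n → N)
    (es : List (N × N × L)) (i : Fin m → N) :
    evalEdges (P := Circ L) (cospanToCirc L) (fun ℓ => CircuitClass.mk (Circuit.edge ℓ)) o es m i =
      CircuitClass.mk (ofList i o es) := by
  induction es generalizing m with
  | nil =>
    refine CircuitClass.mk_eq ⟨⟨⟨Equiv.refl _, fun _ => rfl, fun _ => rfl⟩,
      ⟨fun e => e.elim, fun e => e.down.elim0, fun e => e.elim, fun e => e.down.elim0⟩,
      fun e => e.elim, fun e => e.elim, fun e => e.elim⟩⟩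
  | cons e es ih =>
    simp only [evalEdges, addEdge, ih, edgeState_circ]
    -- The output leg of the new state beside `m` wires is a bijection onto its nodes. Composing
    -- with it therefore keeps the node set `N` and adds one edge between the two prescribed nodes.
    have h := IsSetPushout.of_leftInverse
      (o := fun y : Fin (m + 2) => Sum.map (ULift.up.{u} (α := Fin m))
        ![Sum.inl PUnit.unit.{u + 1}, Sum.inr PUnit.unit.{u + 1}] (finSumFinEquiv.symm y))
      (i := extendPair i e.1 e.2.1)
      (Sum.elim (fun x => finSumFinEquiv (Sum.inl x.down))
        (Sum.elim (fun _ => finSumFinEquiv (Sum.inr 0)) (fun _ => finSumFinEquiv (Sum.inr 1))))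
      ?_ ?_
    · refine (comp_mk_of_isSetPushout
        ((((Cospan.id.{u} (Fin m)).toCircuit L).tensor (stateCircuit e.2.2)).reindex
          finSumFinEquiv.symm finSumFinEquiv.symm) (ofList (extendPair i e.1 e.2.1) o es) h).trans ?_
      refine CircuitClass.mk_eq ⟨⟨⟨Equiv.refl _, fun x => ?_, fun _ => rfl⟩,
        -- The new edge heads the list, so it gets index 0 and the other indices are shifted by one.
        ⟨Sum.elim (Sum.elim (fun e => e.elim) (fun _ => ULift.up 0))
          (fun e => ULift.up e.down.succ),
        fun k => Fin.cases (Sum.inl (Sum.inr PUnit.unit)) (fun k => Sum.inr (ULift.up k)) k.down,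
        ?_, ?_⟩, ?_, ?_, ?_⟩⟩
      · refine Eq.trans ?_ (extendPair_inl i e.1 e.2.1 x)
        refine congrArg (fun z => extendPair i e.1 e.2.1 (Sum.elim _ _ (Sum.map ULift.up
          Fin.elim0 z))) (CircuitClass.symm_cast_add_zero rfl x)
      · rintro ((⟨⟨⟩⟩ | x) | x) <;> rfl
      · rintro ⟨k⟩
        refine Fin.cases ?_ (fun k => ?_) k <;> rfl
      · rintro ((⟨⟨⟩⟩ | x) | x)
        · exact extendPair_inr i e.1 e.2.1 0
        · rfl
      · rintro ((⟨⟨⟩⟩ | x) | x)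
        · exact extendPair_inr i e.1 e.2.1 1
        · rfl
      · rintro ((⟨⟨⟩⟩ | x) | x) <;> rfl
    · rintro (x | (x | x)) <;> simp
    · intro y
      obtain ⟨y, rfl⟩ := finSumFinEquiv.surjective y
      rcases y with y | y
      · simp
      · fin_cases y <;> simp

/-- A morphism out of the prop of circuits is determined by its values on cospans and on single
edges. -/
theorem map_mk (F : PropCat.Hom (Circ L) P)
    (hG : ∀ {m n : ℕ} (f : CospanClass.{u} m n), F.map (f.toCircuit L) = G.map f)
    (ha : ∀ ℓ, F.map (CircuitClass.mk (Circuit.edge ℓ)) = a ℓ)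
    {m n : ℕ} (c : Circuit L (Fin m) (Fin n)) :
    F.map (CircuitClass.mk c) = evalCircuit G a c := by
  -- With `a` taken to be the values of `F` on edges, applying `F` to the normal form in `Circ L`
  -- gives the normal form in `P`.
  obtain rfl : (fun ℓ => F.map (CircuitClass.mk (Circuit.edge ℓ))) = a := funext ha
  rw [mk_eq_ofList, ← evalEdges_circ]
  exact map_evalEdges (cospanToCirc L) _ F G hG c.o _ c.i

end CircuitEval

/-! ### The universal property of the coproduct -/

open CircuitEval in
theorem mainTheorem2 (L : Type u) :
    Nonempty (Limits.IsColimit (Limits.BinaryCofan.mk (cospanToCirc L) (actionToCirc L))) := by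
  -- By freeness, a morphism out of `ActionProp L` enters only through its values on the generators.
  let label {P : PropCat.{u + 1}} (A : PropCat.Hom (ActionProp L) P) (ℓ : L) : P.hom 1 1 :=
    A.map (FreeProp.mk (.gen (.op ℓ)))
  refine ⟨Limits.BinaryCofan.isColimitMk (fun s => evalHom s.inl (label s.inr)) (fun s => ?_)
    (fun s => ?_) (fun s F hl hr => ?_)⟩
  · refine PropCat.Hom.ext ?_
    funext m n f
    exact evalClass_toCircuit s.inl (label s.inr) f
  · refine FreeProp.hom_ext ?_
    rintro _ _ ⟨ℓ⟩
    exact evalClass_edge s.inl (label s.inr) ℓ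
  · refine PropCat.Hom.ext ?_
    funext m n f
    obtain ⟨c, rfl⟩ := CircuitClass.mk_surj f
    refine map_mk s.inl (label s.inr) F (fun f => ?_) (fun ℓ => ?_) c
    · exact congrArg (fun H : PropCat.Hom FinCospan.{u} s.pt => H.map f) hl
    · exact congrArg (fun H : PropCat.Hom (ActionProp L) s.pt =>
        H.map (FreeProp.mk (.gen (.op ℓ)))) hr
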